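/- Digraphs are finite and simple (no loops and no multiple arcs; two opposite arcs between a pair of vertices are allowed). A complementarity eigenvalue of a digraph $D$ with adjacency matrix $A$ is a real number $\lambda$ for which there is a vector $x\neq 0$ with $x\ge 0$ and $Ax\ge\lambda x$ (entrywise) and $\langle x, Ax-\lambda x\rangle=0$. Write $\vec C_n$ for the directed cycle $1\to 2\to\cdots\to n\to 1$ ($n\ge 2$). **Theorem.** Let $D$ be a strongly connected digraph with exactly three complementarity eigenvalues. Then $D$ belongs to the $\infty$-family (items 1–3) or to the $\theta$-family (items 4–7); that is, $D$ is isomorphic to one of the following digraphs. 1. An $\infty$-digraph $\infty(r,s)$, $r,s\ge 2$: the union of two cycles $\vec C_r$ with vertices $1,2,\dots,r$ and $\vec C_s$ with vertices $1',2',\dots,s'$, which have exactly the vertex $1=1'$ in common. 2. A Type 1 digraph: $\infty(r,s)$ together with the arc $(r,2')$, where $r,s\ge2$. 3. A Type 2 digraph: $\infty(r,s)$ together with the arcs $(r,2')$ and $(s',2)$, where $r,s\ge2$. 4. A $\theta$-digraph $\theta(a,b,c)$ with integers $0\le a\le b$, $b>0$, $c\ge 0$: the union of three directed paths with $a+2$,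 $b+2$, $c+2$ vertices, the first two leading from a vertex $w$ to a vertex $v\ne w$ and the third from $v$ to $w$, no two of which share a vertex other than $v$ and $w$. 5. A Type 3 digraph: $\vec C_n$ together with the arcs $(1,i)$ and $(i-1,j)$, where $2<i<j\le n$. 6. A Type 4 digraph: $\vec C_n$ together with $k\ge 2$ arcs $(x_1,y_1),\dots,(x_k,y_k)$, where $1\le y_1<x_1<y_2<x_2<\cdots<y_k<x_k\le n$. 7. A Type 5 digraph: $\vec C_n$ together with the arcs $(1,i)$, $(i-1,j)$ and $(j-1,2)$, where $3<i<i+1<j\le n$. -/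

import Mathlib

namespace CompSpec

/-- `lam` is a complementarity eigenvalue of the real square matrix `A`: there is a nonzero
entrywise nonnegative vector `x` with `A x ≥ lam x` entrywise and `⟨x, A x - lam x⟩ = 0`. -/
def IsComplementarityEigenvalue {V : Type*} [Fintype V] (A : Matrix V V ℝ) (lam : ℝ) : Prop :=
  ∃ x : V → ℝ, x ≠ 0 ∧ (∀ i, 0 ≤ x i) ∧ (∀ i, lam * x i ≤ (A.mulVec x) i) ∧
    x ⬝ᵥ (A.mulVec x - lam • x) = 0

/-- The complementarity spectrum of a real square matrix. -/
def matrixComplementaritySpectrum {V : Type*} [Fintype V] (A : Matrix V V ℝ) : Set ℝ :=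
  {lam | IsComplementarityEigenvalue A lam}

open Classical in
/-- The adjacency matrix of a digraph. -/
noncomputable def adjMatrix {V : Type*} (D : Digraph V) : Matrix V V ℝ :=
  Matrix.of fun i j => if D.Adj i j then 1 else 0

/-- The complementarity spectrum of a finite digraph. -/
noncomputable def complementaritySpectrum {V : Type*} [Fintype V] (D : Digraph V) : Set ℝ :=
  matrixComplementaritySpectrum (adjMatrix D)

/-- A digraph is simple if it has no loops (parallel arcs do not exist for `Digraph`; a pair of
opposite arcs is allowed). -/
def IsSimple {V : Type*} (D : Digraph V) : Prop := ∀ v, ¬ D.Adj v v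

/-- Every vertex can be reached from every vertex along a directed path. -/
def IsStronglyConnected {V : Type*} (D : Digraph V) : Prop :=
  Nonempty V ∧ ∀ u v, Relation.ReflTransGen D.Adj u v

/-- `(u, v)` is an arc of the directed cycle whose vertices are, in order,
`p 1, p 2, …, p r` (labels are read modulo `r`, so `p r` is followed by `p 1`). -/
def CycleArc {V : Type*} {r : ℕ} (p : ZMod r → V) (u v : V) : Prop :=
  ∃ k : ZMod r, u = p k ∧ v = p (k + 1)

/-- `(u, v)` is an arc of the directed path `P 0, P 1, …, P (m + 1)`. -/
def PathArc {V : Type*} {m : ℕ} (P : Fin (m + 2) → V) (u v : V) : Prop :=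
  ∃ k : Fin (m + 1), u = P k.castSucc ∧ v = P k.succ

/-- `p` labels the vertices of a cycle of length `r ≥ 2` by `1, 2, …, r`, and `q` those of a cycle
of length `s ≥ 2` by `1', 2', …, s'`; the two cycles share exactly the vertex `1 = 1'`, and
together they cover `V`. -/
structure IsCoalescence {V : Type*} (r s : ℕ) (p : ZMod r → V) (q : ZMod s → V) : Prop where
  two_le_left : 2 ≤ r
  two_le_right : 2 ≤ s
  left_injective : Function.Injective p
  right_injective : Function.Injective q
  base : p 1 = q 1
  meet : ∀ i j, p i = q j → i = 1 ∧ j = 1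
  cover : ∀ v, (∃ i, p i = v) ∨ (∃ j, q j = v)

/-- `D` is an `∞`-digraph: the coalescence of two cycles at one vertex. -/
def IsInftyDigraph {V : Type*} (D : Digraph V) : Prop :=
  ∃ (r s : ℕ) (p : ZMod r → V) (q : ZMod s → V), IsCoalescence r s p q ∧
    ∀ u v, D.Adj u v ↔ CycleArc p u v ∨ CycleArc q u v

/-- Type 1: `∞(r, s)` together with the arc `(r, 2')`. -/
def IsType1 {V : Type*} (D : Digraph V) : Prop :=
  ∃ (r s : ℕ) (p : ZMod r → V) (q : ZMod s → V), IsCoalescence r s p q ∧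
    ∀ u v, D.Adj u v ↔ CycleArc p u v ∨ CycleArc q u v ∨ (u = p (r : ZMod r) ∧ v = q 2)

/-- Type 2: `∞(r, s)` together with the arcs `(r, 2')` and `(s', 2)`. -/
def IsType2 {V : Type*} (D : Digraph V) : Prop :=
  ∃ (r s : ℕ) (p : ZMod r → V) (q : ZMod s → V), IsCoalescence r s p q ∧
    ∀ u v, D.Adj u v ↔ CycleArc p u v ∨ CycleArc q u v ∨
      (u = p (r : ZMod r) ∧ v = q 2) ∨ (u = q (s : ZMod s) ∧ v = p 2)

/-- `P`, `Q`, `R` are directed paths with `a + 2`, `b + 2`, `c + 2` vertices that together cover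
`V`; `P` and `Q` lead from `w` to `v`, `R` leads from `v` to `w`, and apart from `v` and `w`
no two of them have a vertex in common. Since multiple arcs are not allowed, `a` and `b` are
not both zero, and one takes `a ≤ b`. -/
structure IsThetaPaths {V : Type*} (a b c : ℕ) (w v : V)
    (P : Fin (a + 2) → V) (Q : Fin (b + 2) → V) (R : Fin (c + 2) → V) : Prop where
  le : a ≤ b
  pos : 0 < b
  injective_P : Function.Injective P
  injective_Q : Function.Injective Q
  injective_R : Function.Injective R
  start_P : P 0 = w
  start_Q : Q 0 = w
  start_R : R 0 = v
  end_P : P (Fin.last _) = v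
  end_Q : Q (Fin.last _) = v
  end_R : R (Fin.last _) = w
  meet_PQ : ∀ i j, P i = Q j → P i = w ∨ P i = v
  meet_PR : ∀ i j, P i = R j → P i = w ∨ P i = v
  meet_QR : ∀ i j, Q i = R j → Q i = w ∨ Q i = v
  cover : ∀ x, (∃ i, P i = x) ∨ (∃ i, Q i = x) ∨ (∃ i, R i = x)

/-- `D` is a `θ`-digraph `θ(a, b, c)`. -/
def IsThetaDigraph {V : Type*} (D : Digraph V) : Prop :=
  ∃ (a b c : ℕ) (w v : V) (P : Fin (a + 2) → V) (Q : Fin (b + 2) → V) (R : Fin (c + 2) → V),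
    IsThetaPaths a b c w v P Q R ∧
    ∀ x y, D.Adj x y ↔ PathArc P x y ∨ PathArc Q x y ∨ PathArc R x y

/-- Type 3: a spanning cycle `1, 2, …, n` together with the arcs `(1, i)` and `(i - 1, j)`,
where `2 < i < j ≤ n`. -/
def IsType3 {V : Type*} (D : Digraph V) : Prop :=
  ∃ (n : ℕ) (p : ZMod n → V) (i j : ℕ), Function.Bijective p ∧ 2 < i ∧ i < j ∧ j ≤ n ∧
    ∀ u v, D.Adj u v ↔ CycleArc p u v ∨
      (u = p 1 ∧ v = p (i : ZMod n)) ∨ (u = p ((i - 1 : ℕ) : ZMod n) ∧ v = p (j : ZMod n))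

/-- Type 4: a spanning cycle `1, 2, …, n` together with `k ≥ 2` arcs `(x_i, y_i)`, where
`1 ≤ y_1 < x_1 < y_2 < x_2 < ⋯ < y_k < x_k ≤ n`. -/
def IsType4 {V : Type*} (D : Digraph V) : Prop :=
  ∃ (n : ℕ) (p : ZMod n → V) (k : ℕ) (x y : Fin k → ℕ), Function.Bijective p ∧ 2 ≤ k ∧
    (∀ i, 1 ≤ y i ∧ y i < x i ∧ x i ≤ n) ∧ (∀ i j, i < j → x i < y j) ∧
    ∀ u v, D.Adj u v ↔ CycleArc p u v ∨
      ∃ i, u = p (x i : ZMod n) ∧ v = p (y i : ZMod n)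

/-- Type 5: a spanning cycle `1, 2, …, n` together with the arcs `(1, i)`, `(i - 1, j)` and
`(j - 1, 2)`, where `3 < i < i + 1 < j ≤ n`. -/
def IsType5 {V : Type*} (D : Digraph V) : Prop :=
  ∃ (n : ℕ) (p : ZMod n → V) (i j : ℕ), Function.Bijective p ∧ 3 < i ∧ i + 1 < j ∧ j ≤ n ∧
    ∀ u v, D.Adj u v ↔ CycleArc p u v ∨
      (u = p 1 ∧ v = p (i : ZMod n)) ∨ (u = p ((i - 1 : ℕ) : ZMod n) ∧ v = p (j : ZMod n)) ∨
      (u = p ((j - 1 : ℕ) : ZMod n) ∧ v = p 2)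

/-- The `∞`-family. -/
def InftyFamily {V : Type*} (D : Digraph V) : Prop :=
  IsInftyDigraph D ∨ IsType1 D ∨ IsType2 D

/-- The `θ`-family. -/
def ThetaFamily {V : Type*} (D : Digraph V) : Prop :=
  IsThetaDigraph D ∨ IsType3 D ∨ IsType4 D ∨ IsType5 D

end CompSpec

/-!
The complementarity eigenvalues of `D` are the Perron roots of its strongly connected induced
subdigraphs. A single vertex gives `0`, an induced cycle gives `1`, and `D` itself gives its Perron
root `ρ`, which is larger than that of every proper induced subdigraph. With three eigenvalues,
every proper strongly connected induced subdigraph therefore has Perron root at most `1`, which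
means that no vertex of it has two out-neighbours in it; call such a `D` thin.

Some vertex of `D` branches, as otherwise `D` is a cycle. Take an induced cycle and a shortest ear
`p` on it. The cycle together with the ear is strongly connected and contains a branching vertex, so
thinness makes it all of `D`, and only the chords remain to be located. If the ear leaves the cycle
at `x` and returns to it elsewhere than right after `x`, the ear and the cycle segment from the
return point to `x` form a proper strongly connected subdigraph: it has no chord, so at most one
further arc enters and at most one further arc leaves the ear, and `D` consists of three directed
paths with at most two additional arcs. If every ear arc returns right after `x`, the chords are
backward arcs of the ear, and the cycles that they close are pairwise disjoint.
-/

namespace CompSpec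

open Matrix Relation

section Perron

variable {W : Type*} [Fintype W] {A : Matrix W W ℝ} {μ : ℝ} {y : W → ℝ}

/-- A subeigenvector of `A` at `μ`: a nonzero nonnegative vector `y` with `A y ≥ μ y`. These are
the vectors over which the Collatz–Wielandt formula for the Perron root maximises `μ`. -/
structure IsSubeigenvector (A : Matrix W W ℝ) (μ : ℝ) (y : W → ℝ) : Prop where
  nonneg : ∀ i, 0 ≤ y i
  ne_zero : y ≠ 0
  le : ∀ i, μ * y i ≤ (A *ᵥ y) i

/-- The Perron root of a nonnegative matrix, by the Collatz–Wielandt formula. -/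
noncomputable def perronRoot (A : Matrix W W ℝ) : ℝ :=
  sSup {μ | ∃ y, IsSubeigenvector A μ y}

theorem mulVec_nonneg (hA : ∀ i j, 0 ≤ A i j) (hy : ∀ i, 0 ≤ y i) (i : W) : 0 ≤ (A *ᵥ y) i :=
  Finset.sum_nonneg fun j _ => mul_nonneg (hA i j) (hy j)

theorem mulVec_pos (hA : ∀ i j, 0 ≤ A i j) (hy : ∀ i, 0 ≤ y i) {i j : W} (hij : 0 < A i j)
    (hj : 0 < y j) : 0 < (A *ᵥ y) i :=
  Finset.sum_pos' (fun k _ => mul_nonneg (hA i k) (hy k)) ⟨j, Finset.mem_univ _, mul_pos hij hj⟩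

theorem exists_pos_of_nonneg_of_ne_zero {ι : Type*} {z : ι → ℝ} (hz : ∀ i, 0 ≤ z i)
    (hne : z ≠ 0) : ∃ i, 0 < z i := by
  obtain ⟨i, hi⟩ := Function.ne_iff.1 hne
  exact ⟨i, (hz i).lt_of_ne' hi⟩

theorem IsSubeigenvector.sum_pos (h : IsSubeigenvector A μ y) : 0 < ∑ i, y i := by
  obtain ⟨i, hi⟩ := exists_pos_of_nonneg_of_ne_zero h.nonneg h.ne_zero
  exact Finset.sum_pos' (fun k _ => h.nonneg k) ⟨i, Finset.mem_univ _, hi⟩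

theorem IsSubeigenvector.smul (h : IsSubeigenvector A μ y) {c : ℝ} (hc : 0 < c) :
    IsSubeigenvector A μ (c • y) where
  nonneg i := mul_nonneg hc.le (h.nonneg i)
  ne_zero := smul_ne_zero hc.ne' h.ne_zero
  le i := by
    simp only [mulVec_smul, Pi.smul_apply, smul_eq_mul, mul_left_comm μ c]
    exact mul_le_mul_of_nonneg_left (h.le i) hc.le

theorem IsSubeigenvector.le_sum (hA : ∀ i j, 0 ≤ A i j) (h : IsSubeigenvector A μ y) :
    μ ≤ ∑ i, ∑ j, A i j := by
  refine le_of_mul_le_mul_right ?_ h.sum_pos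
  calc μ * ∑ i, y i = ∑ i, μ * y i := Finset.mul_sum _ _ _
    _ ≤ ∑ i, ∑ j, A i j * y j := Finset.sum_le_sum fun i _ => h.le i
    _ ≤ ∑ i, ∑ j, A i j * ∑ k, y k :=
        Finset.sum_le_sum fun i _ => Finset.sum_le_sum fun j _ => mul_le_mul_of_nonneg_left
          (Finset.single_le_sum (fun k _ => h.nonneg k) (Finset.mem_univ j)) (hA i j)
    _ = (∑ i, ∑ j, A i j) * ∑ k, y k := by simp only [Finset.sum_mul]

theorem le_perronRoot (hA : ∀ i j, 0 ≤ A i j) (h : IsSubeigenvector A μ y) : μ ≤ perronRoot A :=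
  le_csSup ⟨_, fun _ ⟨_, hz⟩ => hz.le_sum hA⟩ ⟨y, h⟩

theorem isSubeigenvector_zero_one [Nonempty W] (hA : ∀ i j, 0 ≤ A i j) :
    IsSubeigenvector A 0 1 where
  nonneg _ := zero_le_one
  ne_zero := one_ne_zero
  le i := by
    rw [zero_mul]
    exact mulVec_nonneg hA (fun _ => zero_le_one) i

theorem isCompact_setOf_subeigenvector_stdSimplex (A : Matrix W W ℝ) (a b : ℝ) :
    IsCompact (Set.Icc a b ×ˢ stdSimplex ℝ W ∩
      {q : ℝ × (W → ℝ) | ∀ i, q.1 * q.2 i ≤ (A *ᵥ q.2) i}) := by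
  refine (isCompact_Icc.prod (isCompact_stdSimplex ℝ W)).inter_right ?_
  simp only [Set.ofPred_forall]
  refine isClosed_iInter fun i => isClosed_le (by fun_prop) ?_
  simp only [mulVec, dotProduct]
  fun_prop

theorem exists_isSubeigenvector_perronRoot [Nonempty W] (hA : ∀ i j, 0 ≤ A i j) :
    ∃ y, IsSubeigenvector A (perronRoot A) y := by
  have hmem : ∀ {μ z}, IsSubeigenvector A μ z →
      (∑ i, z i)⁻¹ • z ∈ stdSimplex ℝ W ∧ IsSubeigenvector A μ ((∑ i, z i)⁻¹ • z) := by
    intro μ z hz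
    have hz' := hz.smul (inv_pos.2 hz.sum_pos)
    refine ⟨⟨hz'.nonneg, ?_⟩, hz'⟩
    simp only [Pi.smul_apply, smul_eq_mul, ← Finset.mul_sum, inv_mul_cancel₀ hz.sum_pos.ne']
  obtain ⟨h0, h0'⟩ := hmem (isSubeigenvector_zero_one hA)
  obtain ⟨⟨lam, y⟩, ⟨⟨hlam, hy⟩, hle⟩, hmax⟩ :=
    (isCompact_setOf_subeigenvector_stdSimplex A 0 (∑ i, ∑ j, A i j)).exists_isMaxOn
      ⟨(0, _), ⟨⟨le_rfl, h0'.le_sum hA⟩, h0⟩, h0'.le⟩ continuous_fst.continuousOn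
  have hylam : IsSubeigenvector A lam y :=
    ⟨hy.1, fun hy0 => by simpa [hy0] using hy.2, hle⟩
  have hroot : perronRoot A ≤ lam := by
    refine csSup_le ⟨0, 1, isSubeigenvector_zero_one hA⟩ ?_
    rintro μ ⟨z, hz⟩
    rcases lt_or_ge μ 0 with hμ | hμ
    · exact hμ.le.trans hlam.1
    · obtain ⟨h1, h2⟩ := hmem hz
      exact hmax (a := (μ, _)) ⟨⟨⟨hμ, h2.le_sum hA⟩, h1⟩, h2.le⟩
  exact ⟨y, (le_antisymm (le_perronRoot hA hylam) hroot) ▸ hylam⟩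

theorem lt_perronRoot_of_forall_lt [Nonempty W] (hA : ∀ i j, 0 ≤ A i j) (hy : ∀ i, 0 < y i)
    (h : ∀ i, μ * y i < (A *ᵥ y) i) : μ < perronRoot A := by
  obtain ⟨i, hi⟩ := Finite.exists_min fun i => (A *ᵥ y) i / y i
  refine ((lt_div_iff₀ (hy i)).2 (h i)).trans_le (le_perronRoot (y := y) hA ⟨fun j => (hy j).le,
    fun h0 => (hy i).ne' (congrFun h0 i), fun j => ?_⟩)
  exact (le_div_iff₀ (hy j)).1 (hi j)

theorem exists_commute_forall_pos (hA : A.IsIrreducible) :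
    ∃ B : Matrix W W ℝ, Commute A B ∧ ∀ i j, 0 < B i j := by
  classical
  choose k _ hk using (isIrreducible_iff_exists_pow_pos hA.nonneg).1 hA
  refine ⟨∑ i, ∑ j, A ^ k i j,
    .sum_right _ _ _ fun i _ => .sum_right _ _ _ fun j _ => .pow_right (.refl A) _, fun i j => ?_⟩
  have hnonneg : ∀ i' j', 0 ≤ (A ^ k i' j') i j := fun i' j' => pow_apply_nonneg hA.nonneg _ _ _
  simp only [Matrix.sum_apply]
  exact Finset.sum_pos' (fun i' _ => Finset.sum_nonneg fun j' _ => hnonneg i' j')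
    ⟨i, Finset.mem_univ _, Finset.sum_pos' (fun j' _ => hnonneg i j')
      ⟨j, Finset.mem_univ _, hk i j⟩⟩

-- `B y` for a positive `B` commuting with `A` satisfies all inequalities strictly as soon as `y`
-- satisfies one of them strictly.
theorem IsSubeigenvector.lt_perronRoot (hA : A.IsIrreducible) (h : IsSubeigenvector A μ y)
    (hne : A *ᵥ y ≠ μ • y) : μ < perronRoot A := by
  obtain ⟨B, hcomm, hB⟩ := exists_commute_forall_pos hA
  have hBpos : ∀ z : W → ℝ, (∀ i, 0 ≤ z i) → z ≠ 0 → ∀ i, 0 < (B *ᵥ z) i := by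
    intro z hz hz0 i
    obtain ⟨j, hj⟩ := exists_pos_of_nonneg_of_ne_zero hz hz0
    exact mulVec_pos (fun i j => (hB i j).le) hz (hB i j) hj
  obtain ⟨i, -⟩ := exists_pos_of_nonneg_of_ne_zero h.nonneg h.ne_zero
  have : Nonempty W := ⟨i⟩
  refine lt_perronRoot_of_forall_lt hA.nonneg (hBpos y h.nonneg h.ne_zero) fun i => ?_
  have hdefect : 0 < (B *ᵥ (A *ᵥ y - μ • y)) i :=
    hBpos _ (fun j => sub_nonneg.2 (h.le j)) (sub_ne_zero.2 hne) i
  rw [mulVec_sub, mulVec_smul, mulVec_mulVec, ← hcomm.eq, ← mulVec_mulVec] at hdefect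
  exact sub_pos.1 hdefect

theorem pow_mulVec_of_mulVec_eq_smul [DecidableEq W] (h : A *ᵥ y = μ • y) (k : ℕ) :
    (A ^ k) *ᵥ y = μ ^ k • y := by
  induction k with
  | zero => simp
  | succ k ih => rw [pow_succ, ← mulVec_mulVec, h, mulVec_smul, ih, smul_smul, pow_succ']

theorem pos_of_mulVec_eq_smul (hA : A.IsIrreducible) (hy : ∀ i, 0 ≤ y i) (hy0 : y ≠ 0)
    (h : A *ᵥ y = μ • y) (i : W) : 0 < y i := by
  classical
  obtain ⟨j, hj⟩ := exists_pos_of_nonneg_of_ne_zero hy hy0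
  obtain ⟨k, -, hk⟩ := (isIrreducible_iff_exists_pow_pos hA.nonneg).1 hA i j
  have hpos := mulVec_pos (pow_apply_nonneg hA.nonneg k) hy hk hj
  rw [pow_mulVec_of_mulVec_eq_smul h, Pi.smul_apply, smul_eq_mul] at hpos
  exact (hy i).lt_of_ne' (right_ne_zero_of_mul hpos.ne')

theorem IsSubeigenvector.lt_perronRoot_of_apply_eq_zero (hA : A.IsIrreducible)
    (h : IsSubeigenvector A μ y) {i : W} (hi : y i = 0) : μ < perronRoot A :=
  h.lt_perronRoot hA fun heq => (pos_of_mulVec_eq_smul hA h.nonneg h.ne_zero heq i).ne' hi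

theorem mem_matrixComplementaritySpectrum_of_mulVec_eq_smul (hy : ∀ i, 0 ≤ y i) (hy0 : y ≠ 0)
    (h : A *ᵥ y = μ • y) : μ ∈ matrixComplementaritySpectrum A :=
  ⟨y, hy0, hy, fun i => (congrFun h i).ge, by rw [h, sub_self, dotProduct_zero]⟩

theorem perronRoot_mem_matrixComplementaritySpectrum [Nonempty W] (hA : A.IsIrreducible) :
    perronRoot A ∈ matrixComplementaritySpectrum A := by
  obtain ⟨y, hy⟩ := exists_isSubeigenvector_perronRoot hA.nonneg
  refine mem_matrixComplementaritySpectrum_of_mulVec_eq_smul hy.nonneg hy.ne_zero ?_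
  by_contra hne
  exact lt_irrefl _ (hy.lt_perronRoot hA hne)

theorem mulVec_eq_of_pos_of_dotProduct_eq_zero (hy : ∀ i, 0 ≤ y i)
    (hle : ∀ i, μ * y i ≤ (A *ᵥ y) i) (horth : y ⬝ᵥ (A *ᵥ y - μ • y) = 0) {i : W}
    (hi : 0 < y i) : (A *ᵥ y) i = μ * y i := by
  have hterm := (Finset.sum_eq_zero_iff_of_nonneg fun j _ =>
    mul_nonneg (hy j) (sub_nonneg.2 (hle j))).1 horth i (Finset.mem_univ i)
  exact sub_eq_zero.1 ((mul_eq_zero.1 hterm).resolve_left hi.ne')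

section Submatrix

variable {ι : Type*} [Fintype ι] {f : ι → W} {x : ι → ℝ}

theorem mulVec_extend_zero (hf : Function.Injective f) (i : W) :
    (A *ᵥ Function.extend f x 0) i = ∑ j, A i (f j) * x j := by
  refine (Fintype.sum_of_injective f hf _ _ (fun j hj => ?_) fun j => ?_).symm
  · rw [Function.extend_apply' _ _ _ hj, Pi.zero_apply, mul_zero]
  · rw [hf.extend_apply]

theorem mulVec_extend_zero_apply (hf : Function.Injective f) (i : ι) :
    (A *ᵥ Function.extend f x 0) (f i) = (A.submatrix f f *ᵥ x) i :=
  mulVec_extend_zero hf (f i)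

theorem IsSubeigenvector.extend_zero (hf : Function.Injective f) (hA : ∀ i j, 0 ≤ A i j)
    (h : IsSubeigenvector (A.submatrix f f) μ x) :
    IsSubeigenvector A μ (Function.extend f x 0) where
  nonneg i := Function.extend_nonneg (g := x) (e := 0) h.nonneg le_rfl i
  ne_zero h0 := h.ne_zero (funext fun i => by rw [← hf.extend_apply x 0 i, h0, Pi.zero_apply,
    Pi.zero_apply])
  le i := by
    by_cases hi : ∃ a, f a = i
    · obtain ⟨a, rfl⟩ := hi
      rw [hf.extend_apply, mulVec_extend_zero_apply hf]
      exact h.le a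
    · rw [Function.extend_apply' _ _ _ hi, Pi.zero_apply, mul_zero]
      exact mulVec_nonneg hA (Function.extend_nonneg (g := x) (e := 0) h.nonneg le_rfl) i

theorem matrixComplementaritySpectrum_submatrix_subset (hf : Function.Injective f)
    (hA : ∀ i j, 0 ≤ A i j) :
    matrixComplementaritySpectrum (A.submatrix f f) ⊆ matrixComplementaritySpectrum A := by
  rintro μ ⟨x, hx0, hx, hle, horth⟩
  obtain ⟨hx', hx0', hle'⟩ := IsSubeigenvector.extend_zero hf hA ⟨hx, hx0, hle⟩
  refine ⟨_, hx0', hx', hle', ?_⟩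
  rw [← horth]
  refine (Fintype.sum_of_injective f hf _ _ (fun j hj => ?_) fun j => ?_).symm
  · rw [Function.extend_apply' _ _ _ hj, Pi.zero_apply, zero_mul]
  · simp only [Pi.sub_apply, Pi.smul_apply, smul_eq_mul, hf.extend_apply,
      mulVec_extend_zero_apply hf]

theorem perronRoot_submatrix_lt [Nonempty ι] (hf : Function.Injective f) (hA : A.IsIrreducible)
    {i : W} (hi : i ∉ Set.range f) : perronRoot (A.submatrix f f) < perronRoot A := by
  obtain ⟨x, hx⟩ := exists_isSubeigenvector_perronRoot (A := A.submatrix f f)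
    fun i j => hA.nonneg (f i) (f j)
  exact (hx.extend_zero hf hA.nonneg).lt_perronRoot_of_apply_eq_zero hA
    (Function.extend_apply' _ _ _ hi)

end Submatrix

end Perron

section Spectrum

variable {V : Type*} {D : Digraph V}

/-- The subdigraph of `D` induced on a set `S` of vertices. -/
def induce (D : Digraph V) (S : Set V) : Digraph S where
  Adj u v := D.Adj u v

/-- A digraph is thin if its proper strongly connected induced subdigraphs have all out-degrees
at most one, i.e. are single vertices or cycles. This is all that having three complementarity
eigenvalues says about the proper subdigraphs. -/
def IsThin (D : Digraph V) : Prop :=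
  ∀ S : Set V, S ≠ Set.univ → IsStronglyConnected (induce D S) →
    ∀ u ∈ S, ∀ v ∈ S, ∀ w ∈ S, D.Adj u v → D.Adj u w → v = w

theorem IsStronglyConnected.exists_adj [Nontrivial V] (h : IsStronglyConnected D) (u : V) :
    ∃ v, D.Adj u v := by
  obtain ⟨w, hw⟩ := exists_ne u
  obtain rfl | ⟨v, hv, -⟩ := (h.2 u w).cases_head
  · exact absurd rfl hw
  · exact ⟨v, hv⟩

theorem IsStronglyConnected.transGen [Nontrivial V] (h : IsStronglyConnected D) (u v : V) :
    TransGen D.Adj u v := by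
  obtain ⟨w, hw⟩ := h.exists_adj u
  exact .head' hw (h.2 w v)

theorem adjMatrix_apply_of_adj {u v : V} (h : D.Adj u v) : adjMatrix D u v = 1 := by
  simp [adjMatrix, h]

theorem adjMatrix_apply_of_not_adj {u v : V} (h : ¬ D.Adj u v) : adjMatrix D u v = 0 := by
  simp [adjMatrix, h]

theorem adjMatrix_nonneg (D : Digraph V) (u v : V) : 0 ≤ adjMatrix D u v := by
  by_cases h : D.Adj u v <;> simp [adjMatrix, h]

theorem exists_path_toQuiver_adjMatrix {u v : V} (h : TransGen D.Adj u v) :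
    letI := toQuiver (adjMatrix D)
    ∃ q : Quiver.Path u v, 0 < q.length := by
  let := toQuiver (adjMatrix D)
  have arc : ∀ {a b}, D.Adj a b → (a ⟶ b) := fun hab =>
    ⟨by rw [adjMatrix_apply_of_adj hab]; exact one_pos⟩
  induction h with
  | single huv => exact ⟨(arc huv).toPath, one_pos⟩
  | tail _ hbc ih =>
    obtain ⟨q, -⟩ := ih
    exact ⟨q.cons (arc hbc), q.length.succ_pos⟩

theorem IsStronglyConnected.isIrreducible_adjMatrix [Nontrivial V] (h : IsStronglyConnected D) :
    (adjMatrix D).IsIrreducible where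
  nonneg := adjMatrix_nonneg D
  connected u v := exists_path_toQuiver_adjMatrix (h.transGen u v)

variable [Fintype V]

theorem one_lt_perronRoot_adjMatrix (h : IsStronglyConnected D) {u v w : V}
    (huv : D.Adj u v) (huw : D.Adj u w) (hvw : v ≠ w) : 1 < perronRoot (adjMatrix D) := by
  classical
  have : Nontrivial V := ⟨v, w, hvw⟩
  have hrow : ∀ a, (adjMatrix D *ᵥ 1) a = ∑ b, adjMatrix D a b := fun a => by
    simp [mulVec, dotProduct]
  have hone : IsSubeigenvector (adjMatrix D) 1 1 := by
    refine ⟨fun _ => zero_le_one, one_ne_zero, fun a => ?_⟩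
    obtain ⟨b, hab⟩ := h.exists_adj a
    rw [hrow, Pi.one_apply, one_mul, ← adjMatrix_apply_of_adj hab]
    exact Finset.single_le_sum (fun c _ => adjMatrix_nonneg D a c) (Finset.mem_univ b)
  refine hone.lt_perronRoot h.isIrreducible_adjMatrix fun heq => ?_
  have htwo := Finset.sum_le_sum_of_subset_of_nonneg (Finset.subset_univ {v, w})
    fun b _ _ => adjMatrix_nonneg D u b
  rw [Finset.sum_pair hvw, adjMatrix_apply_of_adj huv, adjMatrix_apply_of_adj huw, ← hrow,
    heq, one_smul, Pi.one_apply] at htwo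
  norm_num at htwo

theorem complementaritySpectrum_induce_subset (S : Set V) [Fintype S] :
    complementaritySpectrum (induce D S) ⊆ complementaritySpectrum D :=
  matrixComplementaritySpectrum_submatrix_subset Subtype.val_injective (adjMatrix_nonneg D)

theorem zero_mem_complementaritySpectrum [Nonempty V] (hD : IsSimple D) :
    (0 : ℝ) ∈ complementaritySpectrum D := by
  let v : V := Classical.arbitrary V
  refine matrixComplementaritySpectrum_submatrix_subset (f := fun _ : Unit => v)
    (Function.injective_of_subsingleton _) (adjMatrix_nonneg D)
    (mem_matrixComplementaritySpectrum_of_mulVec_eq_smul (y := 1) (fun _ => zero_le_one)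
      one_ne_zero ?_)
  funext a
  simp [mulVec, dotProduct, adjMatrix_apply_of_not_adj (hD v)]

theorem adjMatrix_mulVec_of_unique_adj {u v : V} (huv : D.Adj u v)
    (huniq : ∀ w, D.Adj u w → w = v) (x : V → ℝ) : (adjMatrix D *ᵥ x) u = x v := by
  simp only [mulVec, dotProduct]
  rw [Fintype.sum_eq_single v, adjMatrix_apply_of_adj huv, one_mul]
  intro w hw
  rw [adjMatrix_apply_of_not_adj fun huw => hw (huniq w huw), zero_mul]

theorem one_mem_complementaritySpectrum {C : Set V} (hC : C.Nonempty)
    (huniq : ∀ u ∈ C, ∃! v, v ∈ C ∧ D.Adj u v) : (1 : ℝ) ∈ complementaritySpectrum D := by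
  classical
  have : Nonempty C := hC.to_subtype
  refine complementaritySpectrum_induce_subset C
    (mem_matrixComplementaritySpectrum_of_mulVec_eq_smul (y := 1) (fun _ => zero_le_one)
      one_ne_zero ?_)
  funext u
  obtain ⟨v, ⟨hv, huv⟩, hunique⟩ := huniq u u.2
  rw [one_smul, adjMatrix_mulVec_of_unique_adj (D := induce D C) (v := ⟨v, hv⟩) huv
    fun w huw => Subtype.ext (hunique w ⟨w.2, huw⟩)]
  rfl

theorem adjMatrix_mulVec_eq_zero_or_apply (hD : ∀ u v w, D.Adj u v → D.Adj u w → v = w)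
    (x : V → ℝ) (u : V) : (adjMatrix D *ᵥ x) u = 0 ∨ ∃ v, (adjMatrix D *ᵥ x) u = x v := by
  by_cases hu : ∃ v, D.Adj u v
  · obtain ⟨v, huv⟩ := hu
    exact Or.inr ⟨v, adjMatrix_mulVec_of_unique_adj huv (fun w huw => hD u w v huw huv) x⟩
  · simp only [not_exists] at hu
    exact Or.inl (by simp [mulVec, dotProduct, adjMatrix_apply_of_not_adj (hu _)])

theorem complementaritySpectrum_subset_zero_one
    (hD : ∀ u v w, D.Adj u v → D.Adj u w → v = w) : complementaritySpectrum D ⊆ {0, 1} := by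
  rintro lam ⟨x, hx0, hx, hle, horth⟩
  rw [Set.mem_insert_iff, Set.mem_singleton_iff, or_iff_not_imp_left]
  intro hlam
  have heq : ∀ {v}, 0 < x v → (adjMatrix D *ᵥ x) v = lam * x v :=
    mulVec_eq_of_pos_of_dotProduct_eq_zero hx hle horth
  obtain ⟨u, hu⟩ := exists_pos_of_nonneg_of_ne_zero hx hx0
  have hpos : 0 < lam := by
    have := mulVec_nonneg (adjMatrix_nonneg D) hx u
    rw [heq hu] at this
    exact (nonneg_of_mul_nonneg_left this hu).lt_of_ne' hlam
  have hnext : ∀ v, 0 < x v → ∃ w, x w = lam * x v := by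
    intro v hv
    rcases adjMatrix_mulVec_eq_zero_or_apply hD x v with h | ⟨w, h⟩
    · exact absurd (h ▸ heq hv) (mul_pos hpos hv).ne
    · exact ⟨w, h ▸ heq hv⟩
  apply le_antisymm
  · obtain ⟨v, -, hmax⟩ := Finset.univ.exists_max_image x ⟨u, Finset.mem_univ u⟩
    have hv : 0 < x v := hu.trans_le (hmax u (Finset.mem_univ u))
    obtain ⟨w, hw⟩ := hnext v hv
    exact (mul_le_iff_le_one_left hv).1 (hw ▸ hmax w (Finset.mem_univ w))
  · obtain ⟨v, hv, hmin⟩ := ({v | 0 < x v} : Finset V).exists_min_image x ⟨u, by simpa using hu⟩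
    rw [Finset.mem_filter_univ] at hv
    obtain ⟨w, hw⟩ := hnext v hv
    refine (le_mul_iff_one_le_left hv).1 (hw ▸ hmin w ?_)
    rw [Finset.mem_filter_univ, hw]
    exact mul_pos hpos hv

theorem isThin_of_ncard_complementaritySpectrum_eq_three (hsimple : IsSimple D)
    (hstrong : IsStronglyConnected D) (hthree : (complementaritySpectrum D).ncard = 3)
    (hone : (1 : ℝ) ∈ complementaritySpectrum D) : IsThin D := by
  classical
  intro S hS hSstrong u hu v hv w hw huv huw
  by_contra hvw
  have : Nontrivial S := ⟨⟨v, hv⟩, ⟨w, hw⟩, fun h => hvw (congrArg Subtype.val h)⟩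
  have : Nontrivial V := ⟨v, w, hvw⟩
  obtain ⟨a, ha⟩ := (Set.ne_univ_iff_exists_notMem S).1 hS
  have hρS : 1 < perronRoot (adjMatrix (induce D S)) :=
    one_lt_perronRoot_adjMatrix (u := ⟨u, hu⟩) (v := ⟨v, hv⟩) (w := ⟨w, hw⟩) hSstrong huv huw
      fun h => hvw (congrArg Subtype.val h)
  have hρ : perronRoot (adjMatrix (induce D S)) < perronRoot (adjMatrix D) :=
    perronRoot_submatrix_lt Subtype.val_injective hstrong.isIrreducible_adjMatrix
      (by rwa [Subtype.range_coe])
  have hsub : ({0, 1, perronRoot (adjMatrix (induce D S)), perronRoot (adjMatrix D)} : Set ℝ) ⊆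
      complementaritySpectrum D := by
    simp only [Set.insert_subset_iff, Set.singleton_subset_iff]
    exact ⟨zero_mem_complementaritySpectrum hsimple, hone,
      complementaritySpectrum_induce_subset S
        (perronRoot_mem_matrixComplementaritySpectrum hSstrong.isIrreducible_adjMatrix),
      perronRoot_mem_matrixComplementaritySpectrum hstrong.isIrreducible_adjMatrix⟩
  have hcard := Set.ncard_le_ncard hsub (Set.finite_of_ncard_ne_zero (by omega))
  rw [hthree, Set.ncard_insert_of_notMem, Set.ncard_insert_of_notMem, Set.ncard_pair hρ.ne]
    at hcard
  · omega
  all_goals simp only [Set.mem_insert_iff, Set.mem_singleton_iff, not_or]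
  · exact ⟨hρS.ne, (hρS.trans hρ).ne⟩
  · exact ⟨zero_ne_one, (one_pos.trans hρS).ne, (one_pos.trans (hρS.trans hρ)).ne⟩

theorem exists_two_adj_of_ncard_complementaritySpectrum_eq_three
    (hthree : (complementaritySpectrum D).ncard = 3) :
    ∃ u v w, D.Adj u v ∧ D.Adj u w ∧ v ≠ w := by
  by_contra! hD
  have hcard := Set.ncard_le_ncard (complementaritySpectrum_subset_zero_one hD)
  rw [hthree, Set.ncard_pair zero_ne_one] at hcard
  omega

end Spectrum

section Walk

variable {V : Type*} {D : Digraph V} {f g : ℕ → V} {n l : ℕ}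

/-- `f 0, …, f n` is a walk of length `n`; the values of `f` beyond `n` are irrelevant. -/
def IsWalk (D : Digraph V) (n : ℕ) (f : ℕ → V) : Prop :=
  ∀ k < n, D.Adj (f k) (f (k + 1))

/-- The sequence `f 0, …, f n, g 0, g 1, …`, used to splice walks. -/
def walkAppend (n : ℕ) (f g : ℕ → V) (k : ℕ) : V :=
  if k ≤ n then f k else g (k - (n + 1))

theorem isWalk_zero (D : Digraph V) (f : ℕ → V) : IsWalk D 0 f :=
  fun _ hk => absurd hk (Nat.not_lt_zero _)

theorem IsWalk.take (hf : IsWalk D n f) (h : l ≤ n) : IsWalk D l f :=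
  fun k hk => hf k (hk.trans_le h)

theorem IsWalk.drop (hf : IsWalk D n f) (k : ℕ) : IsWalk D (n - k) fun j => f (k + j) :=
  fun j hj => hf (k + j) (by omega)

theorem walkAppend_of_le {k : ℕ} (h : k ≤ n) : walkAppend n f g k = f k :=
  if_pos h

theorem walkAppend_add (k : ℕ) : walkAppend n f g (n + 1 + k) = g k := by
  rw [walkAppend, if_neg (by omega), Nat.add_sub_cancel_left]

theorem IsWalk.append (hf : IsWalk D n f) (hfg : D.Adj (f n) (g 0)) (hg : IsWalk D l g) :
    IsWalk D (n + 1 + l) (walkAppend n f g) := by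
  intro k hk
  rcases lt_trichotomy k n with h | rfl | h
  · rw [walkAppend_of_le h.le, walkAppend_of_le h]
    exact hf k h
  · rw [walkAppend_of_le le_rfl, ← add_zero (k + 1), walkAppend_add]
    exact hfg
  · obtain ⟨j, rfl⟩ := Nat.exists_eq_add_of_le h
    rw [Nat.succ_eq_add_one, add_assoc (n + 1), walkAppend_add, walkAppend_add]
    exact hg j (by omega)

theorem image_walkAppend_Iic (n l : ℕ) (f g : ℕ → V) :
    walkAppend n f g '' Set.Iic (n + 1 + l) = f '' Set.Iic n ∪ g '' Set.Iic l := by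
  ext v
  constructor
  · rintro ⟨k, hk, rfl⟩
    by_cases h : k ≤ n
    · exact .inl ⟨k, h, (walkAppend_of_le h).symm⟩
    · obtain ⟨j, rfl⟩ := Nat.exists_eq_add_of_lt (not_le.1 h)
      rw [add_right_comm, walkAppend_add]
      exact .inr ⟨j, by simp only [Set.mem_Iic] at hk ⊢; omega, rfl⟩
  · rintro (⟨k, hk, rfl⟩ | ⟨k, hk, rfl⟩) <;> rw [Set.mem_Iic] at hk
    · exact ⟨k, by rw [Set.mem_Iic]; omega, walkAppend_of_le hk⟩
    · exact ⟨n + 1 + k, by rw [Set.mem_Iic]; omega, walkAppend_add k⟩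

theorem image_add_Iic (f : ℕ → V) {a b : ℕ} (h : a ≤ b) :
    (fun j => f (a + j)) '' Set.Iic (b - a) = f '' Set.Icc a b := by
  rw [← Set.image_image f (a + ·)]
  congr 1
  ext k
  simp only [Set.mem_image, Set.mem_Iic, Set.mem_Icc]
  exact ⟨by rintro ⟨j, hj, rfl⟩; omega, fun hk => ⟨k - a, by omega, by omega⟩⟩

theorem exists_isWalk_of_reflTransGen {u v : V} (h : ReflTransGen D.Adj u v) :
    ∃ n f, IsWalk D n f ∧ f 0 = u ∧ f n = v := by
  induction h with
  | refl => exact ⟨0, fun _ => u, isWalk_zero D _, rfl, rfl⟩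
  | @tail b c _ hbc ih =>
    obtain ⟨n, f, hf, h0, rfl⟩ := ih
    exact ⟨n + 1 + 0, walkAppend n f fun _ => c, hf.append hbc (isWalk_zero D _),
      (walkAppend_of_le n.zero_le).trans h0, walkAppend_add 0⟩

end Walk

section StronglyConnected

variable {V : Type*} {D : Digraph V}

theorem IsWalk.reflTransGen_induce {f : ℕ → V} {n : ℕ} (hf : IsWalk D n f) {S : Set V}
    (hS : ∀ k ≤ n, f k ∈ S) {a b : ℕ} (hab : a ≤ b) (hb : b ≤ n) :
    ReflTransGen (induce D S).Adj ⟨f a, hS a (hab.trans hb)⟩ ⟨f b, hS b hb⟩ := by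
  induction b, hab using Nat.le_induction with
  | base => exact .refl
  | succ b _ ih => exact (ih (by omega)).tail (hf b hb)

theorem IsWalk.isStronglyConnected_induce {f : ℕ → V} {n : ℕ} (hf : IsWalk D n f)
    (hback : D.Adj (f n) (f 0)) : IsStronglyConnected (induce D (f '' Set.Iic n)) := by
  refine ⟨⟨⟨f 0, 0, n.zero_le, rfl⟩⟩, ?_⟩
  rintro ⟨_, a, ha, rfl⟩ ⟨_, b, hb, rfl⟩
  have hmem : ∀ k ≤ n, f k ∈ f '' Set.Iic n := fun k hk => ⟨k, hk, rfl⟩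
  have hback' : (induce D (f '' Set.Iic n)).Adj ⟨f n, hmem n le_rfl⟩ ⟨f 0, hmem 0 n.zero_le⟩ :=
    hback
  exact ((hf.reflTransGen_induce hmem ha le_rfl).tail hback').trans
    (hf.reflTransGen_induce hmem b.zero_le hb)

theorem IsStronglyConnected.induce_union {S T : Set V} (hS : IsStronglyConnected (induce D S))
    (hT : IsStronglyConnected (induce D T)) (hST : (S ∩ T).Nonempty) :
    IsStronglyConnected (induce D (S ∪ T)) := by
  obtain ⟨w, hwS, hwT⟩ := hST
  let hub : ↥(S ∪ T) := ⟨w, .inl hwS⟩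
  have left : ∀ u v : S, ReflTransGen (induce D (S ∪ T)).Adj ⟨u, .inl u.2⟩ ⟨v, .inl v.2⟩ :=
    fun u v => (hS.2 u v).lift (Set.inclusion Set.subset_union_left) fun _ _ h => h
  have right : ∀ u v : T, ReflTransGen (induce D (S ∪ T)).Adj ⟨u, .inr u.2⟩ ⟨v, .inr v.2⟩ :=
    fun u v => (hT.2 u v).lift (Set.inclusion Set.subset_union_right) fun _ _ h => h
  have to_hub : ∀ u, ReflTransGen (induce D (S ∪ T)).Adj u hub := by
    rintro ⟨u, hu | hu⟩
    · exact left ⟨u, hu⟩ ⟨w, hwS⟩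
    · exact right ⟨u, hu⟩ ⟨w, hwT⟩
  have of_hub : ∀ u, ReflTransGen (induce D (S ∪ T)).Adj hub u := by
    rintro ⟨u, hu | hu⟩
    · exact left ⟨w, hwS⟩ ⟨u, hu⟩
    · exact right ⟨w, hwT⟩ ⟨u, hu⟩
  exact ⟨⟨hub⟩, fun u v => (to_hub u).trans (of_hub v)⟩

end StronglyConnected

section InducedCycle

variable {V : Type*} {D : Digraph V} {r : ℕ} {c : ℕ → V}

/-- `c 0, …, c (r - 1)` is an induced cycle of `D`, and `c` continues periodically. -/
structure IsInducedCycle (D : Digraph V) (r : ℕ) (c : ℕ → V) : Prop where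
  two_le : 2 ≤ r
  eq_iff : ∀ a b, c a = c b ↔ a ≡ b [MOD r]
  adj_iff : ∀ a b, D.Adj (c a) (c b) ↔ b ≡ a + 1 [MOD r]

theorem IsInducedCycle.adj_succ (hc : IsInducedCycle D r c) (a : ℕ) : D.Adj (c a) (c (a + 1)) :=
  (hc.adj_iff a _).2 rfl

theorem IsInducedCycle.apply_add_mul (hc : IsInducedCycle D r c) (a k : ℕ) :
    c (a + r * k) = c a :=
  (hc.eq_iff _ _).2 (Nat.add_modulus_mul_modEq_iff.2 rfl)

theorem IsInducedCycle.apply_mod (hc : IsInducedCycle D r c) (a : ℕ) : c (a % r) = c a :=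
  (hc.eq_iff _ _).2 (Nat.mod_modEq a r)

theorem IsInducedCycle.shift (hc : IsInducedCycle D r c) (t : ℕ) :
    IsInducedCycle D r fun k => c (k + t) where
  two_le := hc.two_le
  eq_iff a b := (hc.eq_iff _ _).trans (Nat.ModEq.add_iff_right rfl)
  adj_iff a b := (hc.adj_iff _ _).trans (by
    rw [add_right_comm]
    exact Nat.ModEq.add_iff_right rfl)

theorem IsInducedCycle.existsUnique_adj (hc : IsInducedCycle D r c) {u : V}
    (hu : u ∈ Set.range c) : ∃! v, v ∈ Set.range c ∧ D.Adj u v := by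
  obtain ⟨a, rfl⟩ := hu
  refine ⟨c (a + 1), ⟨⟨_, rfl⟩, hc.adj_succ a⟩, ?_⟩
  rintro _ ⟨⟨b, rfl⟩, hab⟩
  exact (hc.eq_iff _ _).2 ((hc.adj_iff a b).1 hab)

theorem IsInducedCycle.isStronglyConnected_induce (hc : IsInducedCycle D r c) :
    IsStronglyConnected (induce D (Set.range c)) := by
  have hr := hc.two_le
  have hrange : c '' Set.Iic (r - 1) = Set.range c := by
    refine (Set.image_subset_range _ _).antisymm ?_
    rintro _ ⟨k, rfl⟩
    exact ⟨k % r, Nat.le_sub_one_of_lt (Nat.mod_lt k (by omega)), hc.apply_mod k⟩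
  rw [← hrange]
  refine IsWalk.isStronglyConnected_induce (fun k _ => hc.adj_succ k) ((hc.adj_iff _ _).2 ?_)
  rw [show r - 1 + 1 = r by omega]
  exact (Nat.modEq_zero_iff_dvd.2 dvd_rfl).symm

/-- `f 0, …, f r = f 0` is a closed walk of minimum positive length. -/
structure IsShortestClosedWalk (D : Digraph V) (r : ℕ) (f : ℕ → V) : Prop where
  pos : 0 < r
  walk : IsWalk D r f
  closed : f r = f 0
  le : ∀ n g, 0 < n → IsWalk D n g → g n = g 0 → r ≤ n

theorem exists_isShortestClosedWalk (hstrong : IsStronglyConnected D) {u v : V}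
    (huv : D.Adj u v) : ∃ r f, IsShortestClosedWalk D r f := by
  classical
  have hex : ∃ n, 0 < n ∧ ∃ f, IsWalk D n f ∧ f n = f 0 := by
    obtain ⟨n, f, hf, rfl, hfn⟩ := exists_isWalk_of_reflTransGen (hstrong.2 v u)
    refine ⟨n + 1 + 0, by omega, _, hf.append (g := fun _ => f 0) (hfn ▸ huv) (isWalk_zero D _), ?_⟩
    rw [walkAppend_add, walkAppend_of_le n.zero_le]
  obtain ⟨hpos, f, hf, hf0⟩ := Nat.find_spec hex
  exact ⟨_, f, hpos, hf, hf0, fun n g hn hg hg0 => Nat.find_min' hex ⟨hn, g, hg, hg0⟩⟩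

namespace IsShortestClosedWalk

variable {f : ℕ → V} {a b : ℕ}

theorem apply_ne (h : IsShortestClosedWalk D r f) (hab : a < b) (hb : b < r) : f a ≠ f b := by
  intro hfab
  have := h.le (b - a) _ (by omega) ((h.walk.take hb.le).drop a)
    (by simp only [add_zero, Nat.add_sub_cancel' hab.le, hfab])
  omega

theorem eq_zero_of_adj_of_le (h : IsShortestClosedWalk D r f) (hba : b ≤ a) (ha : a < r)
    (hadj : D.Adj (f a) (f b)) : a + 1 = r ∧ b = 0 := by
  have hwalk := ((h.walk.take ha.le).drop b).append (g := fun _ => f b)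
    (by simpa only [Nat.add_sub_cancel' hba] using hadj) (isWalk_zero D _)
  have := h.le _ _ (by omega) hwalk
    (by rw [walkAppend_add, walkAppend_of_le (Nat.zero_le _), add_zero])
  omega

theorem eq_succ_of_adj_of_lt (h : IsShortestClosedWalk D r f) (hab : a < b) (hb : b < r)
    (hadj : D.Adj (f a) (f b)) : b = a + 1 := by
  have hwalk := (h.walk.take (hab.trans hb).le).append (g := fun j => f (b + j)) hadj
    (h.walk.drop b)
  have := h.le _ _ (by omega) hwalk (by
    rw [walkAppend_add, walkAppend_of_le (Nat.zero_le _), Nat.add_sub_cancel' hb.le, h.closed])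
  omega

theorem apply_succ_mod (h : IsShortestClosedWalk D r f) (a : ℕ) :
    f ((a + 1) % r) = f (a % r + 1) := by
  rcases (Nat.succ_le_of_lt (Nat.mod_lt a h.pos)).lt_or_eq with hlt | heq
  · rw [← Nat.mod_add_mod, Nat.mod_eq_of_lt hlt]
  · rw [← Nat.mod_add_mod, ← Nat.succ_eq_add_one, heq, Nat.mod_self, h.closed]

theorem apply_mod_eq_iff (h : IsShortestClosedWalk D r f) (a b : ℕ) :
    f (a % r) = f (b % r) ↔ a ≡ b [MOD r] := by
  refine ⟨fun hab => ?_, fun hab => congrArg f hab⟩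
  rcases lt_trichotomy (a % r) (b % r) with hlt | heq | hgt
  · exact absurd hab (h.apply_ne hlt (Nat.mod_lt b h.pos))
  · exact heq
  · exact absurd hab.symm (h.apply_ne hgt (Nat.mod_lt a h.pos))

theorem isInducedCycle (h : IsShortestClosedWalk D r f) (hsimple : IsSimple D) :
    IsInducedCycle D r fun k => f (k % r) where
  two_le := by
    have := h.pos
    by_contra! hr
    obtain rfl : r = 1 := by omega
    exact hsimple (f 0) (by simpa [h.closed] using h.walk 0 one_pos)
  eq_iff := h.apply_mod_eq_iff
  adj_iff a b := by
    rw [← h.apply_mod_eq_iff, h.apply_succ_mod]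
    refine ⟨fun hadj => ?_, fun hb => hb ▸ h.walk _ (Nat.mod_lt a h.pos)⟩
    rcases lt_or_ge (a % r) (b % r) with hlt | hge
    · rw [h.eq_succ_of_adj_of_lt hlt (Nat.mod_lt b h.pos) hadj]
    · obtain ⟨ha, hb⟩ := h.eq_zero_of_adj_of_le hge (Nat.mod_lt a h.pos) hadj
      rw [ha, hb, h.closed]

end IsShortestClosedWalk

theorem exists_isInducedCycle (hsimple : IsSimple D) (hstrong : IsStronglyConnected D) {u v : V}
    (huv : D.Adj u v) : ∃ r c, IsInducedCycle D r c := by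
  obtain ⟨r, f, hf⟩ := exists_isShortestClosedWalk hstrong huv
  exact ⟨r, _, hf.isInducedCycle hsimple⟩

end InducedCycle

section Ear

variable {V : Type*} {D : Digraph V} {C : Set V} {n : ℕ} {g : ℕ → V}

/-- `g 0, …, g n` is a walk that starts and ends in `C` and leaves `C` at its first step. -/
structure IsEar (D : Digraph V) (C : Set V) (n : ℕ) (g : ℕ → V) : Prop where
  walk : IsWalk D n g
  start_mem : g 0 ∈ C
  one_notMem : g 1 ∉ C
  end_mem : g n ∈ C
  pos : 0 < n

/-- `g 0, …, g n` is an ear on `C` of minimum length. -/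
structure IsShortestEar (D : Digraph V) (C : Set V) (n : ℕ) (g : ℕ → V) : Prop
    extends IsEar D C n g where
  le : ∀ l f, IsEar D C l f → n ≤ l

theorem exists_adj_mem_notMem {u v : V} (huv : ReflTransGen D.Adj u v) (hu : u ∈ C)
    (hv : v ∉ C) : ∃ a ∈ C, ∃ b ∉ C, D.Adj a b := by
  by_contra! hclosed
  refine hv ?_
  clear hv
  induction huv with
  | refl => exact hu
  | @tail b c _ hbc ih =>
    by_contra hc
    exact hclosed b ih c hc hbc

theorem exists_isEar (hstrong : IsStronglyConnected D) (hC : C.Nonempty) (hne : C ≠ Set.univ) :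
    ∃ n g, IsEar D C n g := by
  obtain ⟨u, hu⟩ := hC
  obtain ⟨v, hv⟩ := (Set.ne_univ_iff_exists_notMem C).1 hne
  obtain ⟨a, ha, b, hb, hab⟩ := exists_adj_mem_notMem (hstrong.2 u v) hu hv
  obtain ⟨n, f, hf, rfl, rfl⟩ := exists_isWalk_of_reflTransGen (hstrong.2 b a)
  exact ⟨0 + 1 + n, walkAppend 0 (fun _ => f n) f,
    { walk := (isWalk_zero D _).append hab hf
      start_mem := ha
      one_notMem := hb
      end_mem := by rwa [walkAppend_add]
      pos := by omega }⟩

theorem exists_isShortestEar (hstrong : IsStronglyConnected D) (hC : C.Nonempty)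
    (hne : C ≠ Set.univ) : ∃ n g, IsShortestEar D C n g := by
  classical
  have hex := exists_isEar hstrong hC hne
  obtain ⟨g, hg⟩ := Nat.find_spec hex
  exact ⟨_, g, hg, fun l f hf => Nat.find_min' hex ⟨f, hf⟩⟩

namespace IsShortestEar

variable {a b : ℕ} {u : V}

theorem notMem (h : IsShortestEar D C n g) (ha : 0 < a) (han : a < n) : g a ∉ C := by
  intro hmem
  have := h.le a g ⟨h.walk.take han.le, h.start_mem, h.one_notMem, hmem, ha⟩
  omega

theorem le_of_adj (h : IsShortestEar D C n g) (ha : 0 < a) (han : a ≤ n) (hb : b ≤ n)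
    (hab : D.Adj (g a) (g b)) : b ≤ a + 1 := by
  have := h.le _ (walkAppend a g fun j => g (b + j))
    { walk := (h.walk.take han).append hab (h.walk.drop b)
      start_mem := h.start_mem
      one_notMem := by
        rw [walkAppend_of_le ha]
        exact h.one_notMem
      end_mem := by
        rw [walkAppend_add, Nat.add_sub_cancel' hb]
        exact h.end_mem
      pos := by omega }
  omega

theorem apply_ne (h : IsShortestEar D C n g) (ha : 0 < a) (hab : a < b) (hb : b < n) :
    g a ≠ g b := by
  intro heq
  have := h.le_of_adj ha (by omega) hb (heq ▸ h.walk b hb)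
  omega

theorem le_of_adj_mem (h : IsShortestEar D C n g) (ha : 0 < a) (han : a ≤ n) (hu : u ∈ C)
    (hau : D.Adj (g a) u) : n ≤ a + 1 :=
  h.le _ (walkAppend a g fun _ => u)
    { walk := (h.walk.take han).append hau (isWalk_zero D _)
      start_mem := h.start_mem
      one_notMem := by
        rw [walkAppend_of_le ha]
        exact h.one_notMem
      end_mem := by rwa [← add_zero (a + 1), walkAppend_add]
      pos := by omega }

theorem le_one_of_mem_adj (h : IsShortestEar D C n g) (hb : 0 < b) (hbn : b < n) (hu : u ∈ C)
    (hub : D.Adj u (g b)) : b ≤ 1 := by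
  have := h.le _ (walkAppend 0 (fun _ => u) fun j => g (b + j))
    { walk := (isWalk_zero D _).append hub (h.walk.drop b)
      start_mem := hu
      one_notMem := h.notMem hb hbn
      end_mem := by
        rw [walkAppend_add, Nat.add_sub_cancel' hbn.le]
        exact h.end_mem
      pos := by omega }
  omega

end IsShortestEar

end Ear

section CycleWithEar

variable {V : Type*} {D : Digraph V} {r m : ℕ} {c p : ℕ → V}

/-- `c` is an induced cycle and `p 0, …, p (m - 1)` is a directed path disjoint from it, without
forward chords, such that arcs from the cycle to the path end in `p 0` and arcs from the path to
the cycle start in `p (m - 1)`. -/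
structure IsCycleWithEar (D : Digraph V) (r m : ℕ) (c p : ℕ → V) : Prop where
  cycle : IsInducedCycle D r c
  pos : 0 < m
  inj : ∀ a < m, ∀ b < m, p a = p b → a = b
  disj : ∀ a, ∀ b < m, c a ≠ p b
  walk : IsWalk D (m - 1) p
  noskip : ∀ a < m, ∀ b < m, D.Adj (p a) (p b) → b ≤ a + 1
  enter : ∀ a, ∀ b < m, D.Adj (c a) (p b) → b = 0
  leave : ∀ a < m, ∀ b, D.Adj (p a) (c b) → a + 1 = m

theorem IsShortestEar.isCycleWithEar {n : ℕ} {g : ℕ → V} (hc : IsInducedCycle D r c)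
    (h : IsShortestEar D (Set.range c) n g) :
    IsCycleWithEar D r (n - 1) c fun k => g (k + 1) where
  cycle := hc
  pos := by
    have := h.pos
    by_contra hn
    obtain rfl : n = 1 := by omega
    exact h.one_notMem h.end_mem
  inj a ha b hb hab := by
    rcases lt_trichotomy a b with hlt | heq | hgt
    · exact absurd hab (h.apply_ne (by omega) (by omega) (by omega))
    · exact heq
    · exact absurd hab.symm (h.apply_ne (by omega) (by omega) (by omega))
  disj a b hb hab := h.notMem (by omega) (by omega) ⟨a, hab⟩
  walk k hk := h.walk (k + 1) (by omega)
  noskip a ha b hb hab := by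
    have := h.le_of_adj (by omega) (by omega) (by omega) hab
    omega
  enter a b hb hab := by
    have := h.le_one_of_mem_adj (by omega) (by omega) (Set.mem_range_self a) hab
    omega
  leave a ha b hab := by
    have := h.le_of_adj_mem (by omega) (by omega) (Set.mem_range_self b) hab
    omega

theorem exists_isCycleWithEar (hsimple : IsSimple D) (hstrong : IsStronglyConnected D)
    {u v w : V} (huv : D.Adj u v) (huw : D.Adj u w) (hvw : v ≠ w) :
    ∃ r m c p x y, IsCycleWithEar D r m c p ∧ D.Adj (c x) (p 0) ∧ D.Adj (p (m - 1)) (c y) := by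
  obtain ⟨r, c, hc⟩ := exists_isInducedCycle hsimple hstrong huv
  have hne : Set.range c ≠ Set.univ := by
    intro huniv
    have hmem : ∀ a, a ∈ Set.range c := fun a => huniv ▸ Set.mem_univ a
    exact hvw ((hc.existsUnique_adj (hmem u)).unique ⟨hmem v, huv⟩ ⟨hmem w, huw⟩)
  obtain ⟨n, g, hg⟩ := exists_isShortestEar hstrong (Set.range_nonempty c) hne
  have h := hg.isCycleWithEar hc
  obtain ⟨x, hx⟩ := hg.start_mem
  obtain ⟨y, hy⟩ := hg.end_mem
  refine ⟨r, n - 1, c, _, x, y, h, hx ▸ hg.walk 0 hg.pos, ?_⟩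
  have hlast := hg.walk (n - 1) (by have := h.pos; omega)
  have hpos := h.pos
  rwa [Nat.sub_add_cancel hg.pos, ← hy, show n - 1 = n - 1 - 1 + 1 by omega] at hlast

namespace IsCycleWithEar

variable {x y a b : ℕ}

theorem shift (h : IsCycleWithEar D r m c p) (t : ℕ) :
    IsCycleWithEar D r m (fun k => c (k + t)) p where
  cycle := h.cycle.shift t
  pos := h.pos
  inj := h.inj
  disj a := h.disj (a + t)
  walk := h.walk
  noskip := h.noskip
  enter a := h.enter (a + t)
  leave a ha b := h.leave a ha (b + t)

theorem notMem_segment (h : IsCycleWithEar D r m c p) (hxy : x + 1 < y + r) :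
    c (x + 1) ∉ p '' Set.Iio m ∪ c '' Set.Icc y x := by
  rintro (⟨b, hb, heq⟩ | ⟨a, ⟨hya, hax⟩, heq⟩)
  · exact h.disj _ b hb heq.symm
  · have := ((h.cycle.eq_iff _ _).1 heq.symm).le_of_lt_add (by omega)
    omega

theorem isStronglyConnected_induce_segment (h : IsCycleWithEar D r m c p) (hyx : y ≤ x)
    (hx : D.Adj (c x) (p 0)) (hy : D.Adj (p (m - 1)) (c y)) :
    IsStronglyConnected (induce D (p '' Set.Iio m ∪ c '' Set.Icc y x)) := by
  have hwalk := h.walk.append (g := fun j => c (y + j)) hy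
    fun k (_ : k < x - y) => h.cycle.adj_succ (y + k)
  have hsc := hwalk.isStronglyConnected_induce (by
    rwa [walkAppend_add, walkAppend_of_le (Nat.zero_le _), Nat.add_sub_cancel' hyx])
  have hm : Set.Iic (m - 1) = Set.Iio m := by
    ext k
    have := h.pos
    simp only [Set.mem_Iic, Set.mem_Iio]
    omega
  rwa [image_walkAppend_Iic, hm, image_add_Iic c hyx] at hsc

theorem cover (h : IsCycleWithEar D r m c p) (hthin : IsThin D) (hx : D.Adj (c x) (p 0))
    (hy : D.Adj (p (m - 1)) (c y)) (v : V) : (∃ a, c a = v) ∨ ∃ b < m, p b = v := by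
  wlog hyx : y ≤ x generalizing x
  · have hr := h.cycle.two_le
    exact this (x := x + r * y) (by rwa [h.cycle.apply_add_mul]) (by nlinarith)
  have hsc := h.cycle.isStronglyConnected_induce.induce_union
    (h.isStronglyConnected_induce_segment hyx hx hy) ⟨c x, ⟨x, rfl⟩, .inr ⟨x, ⟨hyx, le_rfl⟩, rfl⟩⟩
  have huniv : Set.range c ∪ (p '' Set.Iio m ∪ c '' Set.Icc y x) = Set.univ := by
    by_contra hne
    exact h.disj (x + 1) 0 h.pos (hthin _ hne hsc (c x) (.inl ⟨x, rfl⟩) _ (.inl ⟨x + 1, rfl⟩) _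
      (.inr (.inl ⟨0, h.pos, rfl⟩)) (h.cycle.adj_succ x) hx)
  rcases huniv ▸ Set.mem_univ v with hv | hv | ⟨a, -, rfl⟩
  · exact .inl hv
  · exact .inr hv
  · exact .inl ⟨a, rfl⟩

theorem eq_of_adj_of_mem_segment (h : IsCycleWithEar D r m c p) (hthin : IsThin D) (hyx : y ≤ x)
    (hxy : x + 1 < y + r) (hx : D.Adj (c x) (p 0)) (hy : D.Adj (p (m - 1)) (c y)) {u v w : V}
    (hu : u ∈ p '' Set.Iio m ∪ c '' Set.Icc y x) (hv : v ∈ p '' Set.Iio m ∪ c '' Set.Icc y x)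
    (hw : w ∈ p '' Set.Iio m ∪ c '' Set.Icc y x) (huv : D.Adj u v) (huw : D.Adj u w) : v = w :=
  hthin _ ((Set.ne_univ_iff_exists_notMem _).2 ⟨_, h.notMem_segment hxy⟩)
    (h.isStronglyConnected_induce_segment hyx hx hy) u hu v hv w hw huv huw

theorem not_adj_enter (h : IsCycleWithEar D r m c p) (hthin : IsThin D) (hxy : x + 1 < y + r)
    (hx : D.Adj (c x) (p 0)) (hy : D.Adj (p (m - 1)) (c y)) (hya : y ≤ a) (hax : a < x) :
    ¬ D.Adj (c a) (p 0) := fun ha =>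
  h.disj (a + 1) 0 h.pos <| h.eq_of_adj_of_mem_segment hthin (hya.trans hax.le) hxy hx hy
    (.inr ⟨a, ⟨hya, hax.le⟩, rfl⟩) (.inr ⟨a + 1, ⟨by omega, hax⟩, rfl⟩) (.inl ⟨0, h.pos, rfl⟩)
    (h.cycle.adj_succ a) ha

theorem not_adj_leave (h : IsCycleWithEar D r m c p) (hthin : IsThin D) (hxy : x + 1 < y + r)
    (hx : D.Adj (c x) (p 0)) (hy : D.Adj (p (m - 1)) (c y)) (hyb : y < b) (hbx : b ≤ x) :
    ¬ D.Adj (p (m - 1)) (c b) := fun hb => by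
  have heq := h.eq_of_adj_of_mem_segment hthin (hyb.le.trans hbx) hxy hx hy
    (.inl ⟨m - 1, Nat.sub_one_lt h.pos.ne', rfl⟩) (.inr ⟨b, ⟨hyb.le, hbx⟩, rfl⟩)
    (.inr ⟨y, ⟨le_rfl, hyb.le.trans hbx⟩, rfl⟩) hb hy
  have := ((h.cycle.eq_iff _ _).1 heq).le_of_lt_add (by omega)
  omega

theorem not_adj_back (h : IsCycleWithEar D r m c p) (hthin : IsThin D) (hyx : y ≤ x)
    (hxy : x + 1 < y + r) (hx : D.Adj (c x) (p 0)) (hy : D.Adj (p (m - 1)) (c y))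
    (hba : b ≤ a) (ha : a < m) : ¬ D.Adj (p a) (p b) := fun hab => by
  have hb : b < m := hba.trans_lt ha
  have hunique := @eq_of_adj_of_mem_segment _ _ _ _ _ _ _ _ h hthin hyx hxy hx hy (p a) (p b)
  rcases (Nat.le_sub_one_of_lt ha).lt_or_eq with hlt | rfl
  · have := h.inj _ hb (a + 1) (by omega) <| hunique (.inl ⟨a, ha, rfl⟩) (.inl ⟨b, hb, rfl⟩)
      (.inl ⟨a + 1, by rw [Set.mem_Iio]; omega, rfl⟩) hab (h.walk a hlt)
    omega
  · exact h.disj y b hb <| .symm <| hunique (.inl ⟨_, ha, rfl⟩) (.inl ⟨b, hb, rfl⟩)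
      (.inr ⟨y, ⟨le_rfl, hyx⟩, rfl⟩) hab hy

theorem isStronglyConnected_induce_image_Icc (h : IsCycleWithEar D r m c p) (hba : b ≤ a)
    (ha : a < m) (hab : D.Adj (p a) (p b)) :
    IsStronglyConnected (induce D (p '' Set.Icc b a)) := by
  rw [← image_add_Iic p hba]
  refine ((h.walk.take (Nat.le_sub_one_of_lt ha)).drop b).isStronglyConnected_induce ?_
  rwa [Nat.add_sub_cancel' hba]

theorem back_disjoint (h : IsCycleWithEar D r m c p) (hthin : IsThin D) {a' b' : ℕ} (hba : b ≤ a)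
    (ha' : a' < m) (hab : D.Adj (p a) (p b)) (hab' : D.Adj (p a') (p b')) (haa' : a ≤ a')
    (hba' : b' ≤ a) : a = a' ∧ b = b' := by
  have hsc := (h.isStronglyConnected_induce_image_Icc hba (haa'.trans_lt ha') hab).induce_union
    (h.isStronglyConnected_induce_image_Icc (hba'.trans haa') ha' hab')
    ⟨p a, ⟨a, ⟨hba, le_rfl⟩, rfl⟩, ⟨a, ⟨hba', haa'⟩, rfl⟩⟩
  have hne : p '' Set.Icc b a ∪ p '' Set.Icc b' a' ≠ Set.univ := by
    intro huniv
    rcases huniv ▸ Set.mem_univ (c 0) with ⟨k, hk, heq⟩ | ⟨k, hk, heq⟩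
    · exact h.disj 0 k (by have := hk.2; omega) heq.symm
    · exact h.disj 0 k (by have := hk.2; omega) heq.symm
  have hunique := hthin _ hne hsc (p a) (.inl ⟨a, ⟨hba, le_rfl⟩, rfl⟩) (p b)
    (.inl ⟨b, ⟨le_rfl, hba⟩, rfl⟩)
  rcases haa'.eq_or_lt with rfl | hlt
  · exact ⟨rfl, h.inj _ (by omega) _ (by omega)
      (hunique (p b') (.inr ⟨b', ⟨le_rfl, hba'⟩, rfl⟩) hab hab')⟩
  · have := h.inj _ (by omega) _ (by omega)
      (hunique (p (a + 1)) (.inr ⟨a + 1, ⟨by omega, hlt⟩, rfl⟩) hab (h.walk a (by omega)))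
    omega

end IsCycleWithEar

end CycleWithEar

section CyclicLabel

variable {V : Type*}

/-- The labels `1, …, n`, read modulo `n`, of the sequence `G 0, …, G (n - 1)`. -/
def cyclicLabel (n : ℕ) (G : ℕ → V) (z : ZMod n) : V :=
  G (z - 1).val

theorem cyclicLabel_natCast_add_one {n : ℕ} (G : ℕ → V) {a : ℕ} (ha : a < n) :
    cyclicLabel n G ((a + 1 : ℕ) : ZMod n) = G a := by
  rw [cyclicLabel, Nat.cast_succ, add_sub_cancel_right, ZMod.val_natCast_of_lt ha]

theorem cyclicLabel_one {n : ℕ} (hn : 0 < n) (G : ℕ → V) : cyclicLabel n G 1 = G 0 := by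
  simpa only [zero_add, Nat.cast_one] using cyclicLabel_natCast_add_one G hn

theorem cyclicLabel_two {n : ℕ} (hn : 1 < n) (G : ℕ → V) : cyclicLabel n G 2 = G 1 := by
  simpa only [one_add_one_eq_two, Nat.cast_ofNat] using cyclicLabel_natCast_add_one G hn

theorem exists_natCast_add_one_eq {n : ℕ} (hn : 0 < n) (z : ZMod n) :
    ∃ a < n, ((a + 1 : ℕ) : ZMod n) = z := by
  have : NeZero n := ⟨hn.ne'⟩
  exact ⟨(z - 1).val, ZMod.val_lt _, by rw [Nat.cast_succ, ZMod.natCast_zmod_val, sub_add_cancel]⟩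

theorem cyclicLabel_injective {n : ℕ} {G : ℕ → V} (hn : 0 < n)
    (hG : Set.InjOn G (Set.Iio n)) : Function.Injective (cyclicLabel n G) := by
  intro y z hyz
  obtain ⟨a, ha, rfl⟩ := exists_natCast_add_one_eq hn y
  obtain ⟨b, hb, rfl⟩ := exists_natCast_add_one_eq hn z
  rw [cyclicLabel_natCast_add_one G ha, cyclicLabel_natCast_add_one G hb] at hyz
  rw [hG ha hb hyz]

theorem cycleArc_cyclicLabel_iff {n : ℕ} (hn : 0 < n) {G : ℕ → V} {u v : V} :
    CycleArc (cyclicLabel n G) u v ↔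
      ∃ a b, a < n ∧ b < n ∧ (b = a + 1 ∨ a + 1 = n ∧ b = 0) ∧ u = G a ∧ v = G b := by
  constructor
  · rintro ⟨z, rfl, rfl⟩
    obtain ⟨a, ha, rfl⟩ := exists_natCast_add_one_eq hn z
    rw [cyclicLabel_natCast_add_one G ha]
    rcases (Nat.succ_le_of_lt ha).lt_or_eq with hlt | heq
    · exact ⟨a, a + 1, ha, hlt, .inl rfl, rfl, by
        rw [← Nat.cast_succ, cyclicLabel_natCast_add_one G hlt]⟩
    · exact ⟨a, 0, ha, hn, .inr ⟨heq, rfl⟩, rfl, by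
        rw [← Nat.succ_eq_add_one a, heq, ZMod.natCast_self, zero_add, cyclicLabel_one hn]⟩
  · rintro ⟨a, b, ha, hb, rfl | ⟨rfl, rfl⟩, rfl, rfl⟩
    · exact ⟨_, (cyclicLabel_natCast_add_one G ha).symm, by
        rw [← Nat.cast_succ, cyclicLabel_natCast_add_one G hb]⟩
    · exact ⟨_, (cyclicLabel_natCast_add_one G ha).symm, by
        rw [ZMod.natCast_self, zero_add, cyclicLabel_one hb]⟩

theorem pathArc_iff {m : ℕ} {G : ℕ → V} {u v : V} :
    PathArc (fun i : Fin (m + 2) => G i) u v ↔ ∃ i < m + 1, u = G i ∧ v = G (i + 1) :=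
  ⟨fun ⟨i, hu, hv⟩ => ⟨i, i.2, hu, hv⟩, fun ⟨i, hi, hu, hv⟩ => ⟨⟨i, hi⟩, hu, hv⟩⟩

end CyclicLabel

section Labelling

variable {V : Type*} {D : Digraph V} {n : ℕ} {F : ℕ → V} {R R' : ℕ → ℕ → Prop}

/-- `F 0, …, F (n - 1)` enumerates the vertices of `D` without repetition, and the arcs of `D` are
described by the relation `R` on the indices below `n`. -/
structure IsLabelling (D : Digraph V) (n : ℕ) (F : ℕ → V) (R : ℕ → ℕ → Prop) : Prop where
  injOn : Set.InjOn F (Set.Iio n)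
  cover : ∀ v, ∃ a < n, F a = v
  adj_iff : ∀ a < n, ∀ b < n, (D.Adj (F a) (F b) ↔ R a b)

namespace IsLabelling

theorem eq_iff (h : IsLabelling D n F R) {a b : ℕ} (ha : a < n) (hb : b < n) :
    F a = F b ↔ a = b :=
  h.injOn.eq_iff ha hb

theorem reindex (h : IsLabelling D n F R) {σ : ℕ → ℕ}
    (hσ : Set.BijOn σ (Set.Iio n) (Set.Iio n))
    (hR : ∀ a < n, ∀ b < n, (R (σ a) (σ b) ↔ R' a b)) : IsLabelling D n (fun k => F (σ k)) R' where
  injOn := h.injOn.comp hσ.injOn hσ.mapsTo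
  cover v := by
    obtain ⟨a, ha, rfl⟩ := h.cover v
    obtain ⟨b, hb, rfl⟩ := hσ.surjOn ha
    exact ⟨b, hb, rfl⟩
  adj_iff a ha b hb := (h.adj_iff _ (hσ.mapsTo ha) _ (hσ.mapsTo hb)).trans (hR a ha b hb)

theorem bijective_cyclicLabel (h : IsLabelling D n F R) (hn : 0 < n) :
    Function.Bijective (cyclicLabel n F) := by
  refine ⟨cyclicLabel_injective hn h.injOn, fun v => ?_⟩
  obtain ⟨a, ha, rfl⟩ := h.cover v
  exact ⟨_, cyclicLabel_natCast_add_one F ha⟩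

theorem cycleArc_comp_iff (h : IsLabelling D n F R) {l : ℕ} (hl : 0 < l) {σ : ℕ → ℕ}
    (hσ : ∀ k < l, σ k < n) {a b : ℕ} (ha : a < n) (hb : b < n) :
    CycleArc (cyclicLabel l fun k => F (σ k)) (F a) (F b) ↔
      ∃ i j, i < l ∧ j < l ∧ (j = i + 1 ∨ i + 1 = l ∧ j = 0) ∧ a = σ i ∧ b = σ j := by
  rw [cycleArc_cyclicLabel_iff hl]
  refine exists_congr fun i => exists_congr fun j => and_congr_right fun hi =>
    and_congr_right fun hj => and_congr_right fun _ => ?_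
  rw [h.eq_iff ha (hσ i hi), h.eq_iff hb (hσ j hj)]

theorem cycleArc_iff (h : IsLabelling D n F R) {l : ℕ} (hl : 0 < l) (hln : l ≤ n) {a b : ℕ}
    (ha : a < n) (hb : b < n) : CycleArc (cyclicLabel l F) (F a) (F b) ↔
      a < l ∧ b < l ∧ (b = a + 1 ∨ a + 1 = l ∧ b = 0) := by
  refine (h.cycleArc_comp_iff (σ := id) hl (fun k hk => hk.trans_le hln) ha hb).trans ?_
  exact ⟨by rintro ⟨_, _, hi, hj, hij, rfl, rfl⟩; exact ⟨hi, hj, hij⟩,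
    fun ⟨hal, hbl, hab⟩ => ⟨a, b, hal, hbl, hab, rfl, rfl⟩⟩

end IsLabelling

/-- Rotation by `t` of the indices `0, …, n - 1`. -/
def rotateIndex (n t k : ℕ) : ℕ :=
  if k + t < n then k + t else k + t - n

theorem bijOn_rotateIndex {t : ℕ} (ht : t < n) :
    Set.BijOn (rotateIndex n t) (Set.Iio n) (Set.Iio n) := by
  refine ⟨fun a ha => ?_, fun a ha b hb hab => ?_, fun a ha => ?_⟩
  · simp only [Set.mem_Iio, rotateIndex] at ha ⊢
    split_ifs <;> omega
  · simp only [Set.mem_Iio, rotateIndex] at ha hb hab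
    split_ifs at hab <;> omega
  · simp only [Set.mem_Iio, Set.mem_image, rotateIndex] at ha ⊢
    by_cases hta : t ≤ a
    · exact ⟨a - t, by omega, by rw [if_pos (by omega)]; omega⟩
    · exact ⟨a + n - t, by omega, by rw [if_neg (by omega)]; omega⟩

end Labelling

section ThreePaths

variable {V : Type*} {D : Digraph V} {η α β : ℕ} {s t : Prop} {F : ℕ → V}

/-- The arcs between three consecutive blocks `H`, `A`, `B` of `η`, `α`, `β` indices: each block is
a directed path, and the last index of `X` is joined to the first index of `Y` for `(X, Y)` equal to
`(H, A)`, `(A, H)`, `(H, B)`, `(B, H)`, for `(A, B)` if `s` holds, and for `(B, A)` if `t` holds. -/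
def threePathRel (η α β : ℕ) (s t : Prop) (a b : ℕ) : Prop :=
  (b = a + 1 ∧ b ≠ η ∧ b ≠ η + α) ∨ (a + 1 = η ∧ (b = η ∨ b = η + α)) ∨
    (a + 1 = η + α ∧ (b = 0 ∨ s ∧ b = η + α)) ∨ (a + 1 = η + α + β ∧ (b = 0 ∨ t ∧ b = η))

/-- The permutation of indices that exchanges the blocks `A` and `B`. -/
def swapIndex (η α β k : ℕ) : ℕ :=
  if k < η then k else if k < η + β then k + α else k - β

theorem bijOn_swapIndex (η α β : ℕ) :
    Set.BijOn (swapIndex η α β) (Set.Iio (η + β + α)) (Set.Iio (η + β + α)) := by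
  refine ⟨fun a ha => ?_, fun a ha b hb hab => ?_, fun a ha => ?_⟩
  · simp only [Set.mem_Iio, swapIndex] at ha ⊢
    split_ifs <;> omega
  · simp only [Set.mem_Iio, swapIndex] at ha hb hab
    split_ifs at hab <;> omega
  · simp only [Set.mem_Iio, Set.mem_image] at ha ⊢
    refine ⟨swapIndex η β α a, ?_, ?_⟩ <;> simp only [swapIndex] <;> split_ifs <;> omega

theorem threePathRel_swapIndex (hη : 0 < η) (hα : 0 < α) (hβ : 0 < β) {a b : ℕ}
    (ha : a < η + β + α) (hb : b < η + β + α) :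
    threePathRel η α β s t (swapIndex η α β a) (swapIndex η α β b) ↔
      threePathRel η β α t s a b := by
  have lastH : swapIndex η α β a + 1 = η ↔ a + 1 = η := by
    unfold swapIndex; split_ifs <;> omega
  have lastA : swapIndex η α β a + 1 = η + α ↔ a + 1 = η + β + α := by
    unfold swapIndex; split_ifs <;> omega
  have lastB : swapIndex η α β a + 1 = η + α + β ↔ a + 1 = η + β := by
    unfold swapIndex; split_ifs <;> omega
  have firstH : swapIndex η α β b = 0 ↔ b = 0 := by
    unfold swapIndex; split_ifs <;> omega
  have firstA : swapIndex η α β b = η ↔ b = η + β := by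
    unfold swapIndex; split_ifs <;> omega
  have firstB : swapIndex η α β b = η + α ↔ b = η := by
    unfold swapIndex; split_ifs <;> omega
  have step : b ≠ η → b ≠ η + β →
      (swapIndex η α β b = swapIndex η α β a + 1 ↔ b = a + 1) := by
    unfold swapIndex; split_ifs <;> omega
  simp only [threePathRel, lastH, lastA, lastB, ne_eq, firstH, firstA, firstB]
  grind

theorem IsLabelling.swap_threePaths (h : IsLabelling D (η + α + β) F (threePathRel η α β s t))
    (hη : 0 < η) (hα : 0 < α) (hβ : 0 < β) :
    ∃ F, IsLabelling D (η + β + α) F (threePathRel η β α t s) := by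
  rw [add_right_comm] at h
  exact ⟨_, h.reindex (bijOn_swapIndex η α β) fun a ha b hb =>
    threePathRel_swapIndex hη hα hβ ha hb⟩

theorem IsLabelling.rotate_threePaths
    (h : IsLabelling D (η + α + β) F (threePathRel η α β True True))
    (hη : 0 < η) (hα : 0 < α) (hβ : 0 < β) :
    ∃ F, IsLabelling D (α + β + η) F (threePathRel α β η True True) := by
  rw [add_assoc, add_comm η] at h
  exact ⟨_, h.reindex (bijOn_rotateIndex (t := η) (by omega)) fun a ha b hb => by
    simp only [threePathRel, rotateIndex, true_and]
    split_ifs <;> omega⟩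

/-- The indices of `H` and `B` when `H` is the single index `0`. -/
def petalIndex (α k : ℕ) : ℕ :=
  if k = 0 then 0 else α + k

theorem petalIndex_lt {k : ℕ} (hk : k < β + 1) : petalIndex α k < 1 + α + β := by
  unfold petalIndex
  split_ifs <;> omega

theorem IsLabelling.isCoalescence {R : ℕ → ℕ → Prop} (h : IsLabelling D (1 + α + β) F R)
    (hα : 0 < α) (hβ : 0 < β) :
    IsCoalescence (α + 1) (β + 1) (cyclicLabel (α + 1) F)
      (cyclicLabel (β + 1) fun k => F (petalIndex α k)) where
  two_le_left := by omega
  two_le_right := by omega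
  left_injective := cyclicLabel_injective α.succ_pos
    (h.injOn.mono (Set.Iio_subset_Iio (by omega)))
  right_injective := by
    refine cyclicLabel_injective β.succ_pos (h.injOn.comp (fun a _ b _ hab => ?_)
      fun k hk => petalIndex_lt hk)
    unfold petalIndex at hab
    split_ifs at hab <;> omega
  base := by
    rw [cyclicLabel_one α.succ_pos, cyclicLabel_one β.succ_pos]
    rfl
  meet i j hij := by
    obtain ⟨a, ha, rfl⟩ := exists_natCast_add_one_eq α.succ_pos i
    obtain ⟨b, hb, rfl⟩ := exists_natCast_add_one_eq β.succ_pos j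
    rw [cyclicLabel_natCast_add_one _ ha, cyclicLabel_natCast_add_one _ hb,
      h.eq_iff (by omega) (petalIndex_lt hb)] at hij
    obtain ⟨rfl, rfl⟩ : a = 0 ∧ b = 0 := by
      unfold petalIndex at hij
      split_ifs at hij <;> omega
    simp only [zero_add, Nat.cast_one, and_self]
  cover v := by
    obtain ⟨a, ha, rfl⟩ := h.cover v
    rcases Nat.lt_or_ge a (α + 1) with hlt | hge
    · exact .inl ⟨_, cyclicLabel_natCast_add_one F hlt⟩
    · refine .inr ⟨(a - α + 1 : ℕ), ?_⟩
      rw [cyclicLabel_natCast_add_one _ (by omega), petalIndex, if_neg (by omega),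
        Nat.add_sub_cancel' (by omega)]

theorem IsLabelling.exists_isCoalescence
    (h : IsLabelling D (1 + α + β) F (threePathRel 1 α β s t)) (hα : 0 < α) (hβ : 0 < β) :
    ∃ (p : ZMod (α + 1) → V) (q : ZMod (β + 1) → V), IsCoalescence (α + 1) (β + 1) p q ∧
      ∀ u v, D.Adj u v ↔ CycleArc p u v ∨ CycleArc q u v ∨
        (s ∧ u = p (α + 1 : ℕ) ∧ v = q 2) ∨ (t ∧ u = q (β + 1 : ℕ) ∧ v = p 2) := by
  refine ⟨_, _, h.isCoalescence hα hβ, fun u v => ?_⟩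
  obtain ⟨a, ha, rfl⟩ := h.cover u
  obtain ⟨b, hb, rfl⟩ := h.cover v
  have right_arc : CycleArc (cyclicLabel (β + 1) fun k => F (petalIndex α k)) (F a) (F b) ↔
      a = 0 ∧ b = α + 1 ∨ α < a ∧ b = a + 1 ∨ a = α + β ∧ b = 0 := by
    rw [h.cycleArc_comp_iff β.succ_pos (fun k hk => petalIndex_lt hk) ha hb]
    constructor
    · rintro ⟨i, j, hi, hj, hij, rfl, rfl⟩
      unfold petalIndex
      split_ifs <;> omega
    · intro hab
      refine ⟨a - α, b - α, by omega, by omega, by omega, ?_, ?_⟩ <;> unfold petalIndex <;>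
        split_ifs <;> omega
  rw [h.adj_iff a ha b hb, h.cycleArc_iff α.succ_pos (by omega) ha hb, right_arc,
    cyclicLabel_natCast_add_one F α.lt_succ_self, cyclicLabel_two (by omega),
    cyclicLabel_natCast_add_one _ β.lt_succ_self, cyclicLabel_two (by omega),
    h.eq_iff ha (by omega), h.eq_iff hb (petalIndex_lt (by omega)),
    h.eq_iff ha (petalIndex_lt (by omega)), h.eq_iff hb (by omega)]
  simp only [threePathRel, petalIndex, hβ.ne', one_ne_zero, if_false]
  grind

theorem IsLabelling.isInftyDigraph
    (h : IsLabelling D (1 + α + β) F (threePathRel 1 α β False False)) (hα : 0 < α)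
    (hβ : 0 < β) : IsInftyDigraph D := by
  obtain ⟨p, q, hpq, hadj⟩ := h.exists_isCoalescence hα hβ
  exact ⟨_, _, p, q, hpq, by simpa only [false_and, or_false] using hadj⟩

theorem IsLabelling.isType1
    (h : IsLabelling D (1 + α + β) F (threePathRel 1 α β True False)) (hα : 0 < α)
    (hβ : 0 < β) : IsType1 D := by
  obtain ⟨p, q, hpq, hadj⟩ := h.exists_isCoalescence hα hβ
  exact ⟨_, _, p, q, hpq, by simpa only [true_and, false_and, or_false] using hadj⟩

theorem IsLabelling.isType2
    (h : IsLabelling D (1 + α + β) F (threePathRel 1 α β True True)) (hα : 0 < α)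
    (hβ : 0 < β) : IsType2 D := by
  obtain ⟨p, q, hpq, hadj⟩ := h.exists_isCoalescence hα hβ
  exact ⟨_, _, p, q, hpq, by simpa only [true_and] using hadj⟩

end ThreePaths

section ThreePathsHamiltonian

variable {V : Type*} {D : Digraph V} {η α β : ℕ} {s t : Prop} {F : ℕ → V}

theorem threePathRel_rotateIndex (hη : 2 ≤ η) (hα : 0 < α) (hβ : 0 < β) {a b : ℕ}
    (ha : a < η + α + β) (hb : b < η + α + β) :
    threePathRel η α β True t (rotateIndex (η + α + β) (η - 1) a)
        (rotateIndex (η + α + β) (η - 1) b) ↔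
      (b = a + 1 ∨ a + 1 = η + α + β ∧ b = 0) ∨ (a = 0 ∧ b = α + 1) ∨
        (a = α ∧ b = α + β + 1) ∨ (t ∧ a = α + β ∧ b = 1) := by
  set σ := rotateIndex (η + α + β) (η - 1) with hσ
  have lastH : σ a + 1 = η ↔ a = 0 := by
    rw [hσ]; unfold rotateIndex; split_ifs <;> omega
  have lastA : σ a + 1 = η + α ↔ a = α := by
    rw [hσ]; unfold rotateIndex; split_ifs <;> omega
  have lastB : σ a + 1 = η + α + β ↔ a = α + β := by
    rw [hσ]; unfold rotateIndex; split_ifs <;> omega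
  have firstH : σ b = 0 ↔ b = α + β + 1 := by
    rw [hσ]; unfold rotateIndex; split_ifs <;> omega
  have firstA : σ b = η ↔ b = 1 := by
    rw [hσ]; unfold rotateIndex; split_ifs <;> omega
  have firstB : σ b = η + α ↔ b = α + 1 := by
    rw [hσ]; unfold rotateIndex; split_ifs <;> omega
  have step : σ b = σ a + 1 ↔
      b ≠ α + β + 1 ∧ (b = a + 1 ∨ a + 1 = η + α + β ∧ b = 0) := by
    rw [hσ]; unfold rotateIndex; split_ifs <;> omega
  simp only [threePathRel, lastH, lastA, lastB, ne_eq, firstH, firstA, firstB, step]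
  grind

theorem IsLabelling.exists_hamiltonian
    (h : IsLabelling D (η + α + β) F (threePathRel η α β True t)) (hη : 2 ≤ η) (hα : 0 < α)
    (hβ : 0 < β) :
    ∃ p : ZMod (η + α + β) → V, Function.Bijective p ∧
      ∀ u v, D.Adj u v ↔ CycleArc p u v ∨
        (u = p 1 ∧ v = p (α + 2 : ℕ)) ∨ (u = p (α + 1 : ℕ) ∧ v = p (α + β + 2 : ℕ)) ∨
        (t ∧ u = p (α + β + 1 : ℕ) ∧ v = p 2) := by
  have rotated := h.reindex (bijOn_rotateIndex (t := η - 1) (by omega)) fun a ha b hb =>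
    threePathRel_rotateIndex (t := t) hη hα hβ ha hb
  refine ⟨_, rotated.bijective_cyclicLabel (by omega), fun u v => ?_⟩
  obtain ⟨a, ha, rfl⟩ := rotated.cover u
  obtain ⟨b, hb, rfl⟩ := rotated.cover v
  rw [rotated.adj_iff a ha b hb, rotated.cycleArc_iff (by omega) le_rfl ha hb,
    cyclicLabel_one (by omega), cyclicLabel_two (by omega),
    cyclicLabel_natCast_add_one _ (by omega : α + 1 < η + α + β),
    cyclicLabel_natCast_add_one _ (by omega : α < η + α + β),
    cyclicLabel_natCast_add_one _ (by omega : α + β + 1 < η + α + β),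
    cyclicLabel_natCast_add_one _ (by omega : α + β < η + α + β),
    rotated.eq_iff ha (by omega), rotated.eq_iff hb (by omega), rotated.eq_iff ha (by omega),
    rotated.eq_iff hb (by omega), rotated.eq_iff ha (by omega), rotated.eq_iff hb (by omega)]
  simp only [ha, hb, true_and]

theorem IsLabelling.isType3
    (h : IsLabelling D (η + α + β) F (threePathRel η α β True False)) (hη : 2 ≤ η)
    (hα : 0 < α) (hβ : 0 < β) : IsType3 D := by
  obtain ⟨p, hp, hadj⟩ := h.exists_hamiltonian hη hα hβ
  exact ⟨_, p, α + 2, α + β + 2, hp, by omega, by omega, by omega, by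
    simp only [false_and, or_false] at hadj
    exact hadj⟩

theorem IsLabelling.isType5
    (h : IsLabelling D (η + α + β) F (threePathRel η α β True True)) (hη : 2 ≤ η)
    (hα : 2 ≤ α) (hβ : 2 ≤ β) : IsType5 D := by
  obtain ⟨p, hp, hadj⟩ := h.exists_hamiltonian hη (by omega) (by omega)
  exact ⟨_, p, α + 2, α + β + 2, hp, by omega, by omega, by omega, by
    simp only [true_and] at hadj
    exact hadj⟩

end ThreePathsHamiltonian

section ThreePathsTheta

variable {V : Type*} {D : Digraph V} {η α β : ℕ} {s t : Prop} {F : ℕ → V}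

/-- The indices of the path from the last index of `H` through the `l` consecutive indices
starting at `o` to the first index of `H`. -/
def detourIndex (η o l i : ℕ) : ℕ :=
  if i = 0 then η - 1 else if i ≤ l then o + i - 1 else 0

theorem detourIndex_lt {o l n : ℕ} (hη : 0 < η) (hηo : η ≤ o) (hol : o + l ≤ n) (i : ℕ) :
    detourIndex η o l i < n := by
  unfold detourIndex
  split_ifs <;> omega

theorem IsLabelling.injective_comp_detourIndex {R : ℕ → ℕ → Prop} {n o l : ℕ}
    (h : IsLabelling D n F R) (hη : 2 ≤ η) (hηo : η ≤ o) (hol : o + l ≤ n) :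
    Function.Injective fun i : Fin (l + 2) => F (detourIndex η o l i) := by
  intro i j hij
  rw [h.eq_iff (detourIndex_lt (by omega) hηo hol i)
    (detourIndex_lt (by omega) hηo hol j)] at hij
  unfold detourIndex at hij
  split_ifs at hij <;> omega

theorem IsLabelling.meet_comp_detourIndex {R : ℕ → ℕ → Prop} {n o l k : ℕ}
    (h : IsLabelling D n F R) (hη : 0 < η) (hηo : η ≤ o) (hol : o + l ≤ n) (hk : k < n)
    (hko : k < o ∨ o + l ≤ k) (i : ℕ) (hik : F (detourIndex η o l i) = F k) :
    F (detourIndex η o l i) = F (η - 1) ∨ F (detourIndex η o l i) = F 0 := by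
  rw [h.eq_iff (detourIndex_lt hη hηo hol i) hk] at hik
  rw [h.eq_iff (detourIndex_lt hη hηo hol i) (by omega),
    h.eq_iff (detourIndex_lt hη hηo hol i) (by omega)]
  unfold detourIndex at hik ⊢
  split_ifs at hik ⊢ <;> omega

theorem IsLabelling.pathArc_detourIndex_iff {R : ℕ → ℕ → Prop} {n o l a b : ℕ}
    (h : IsLabelling D n F R) (hη : 0 < η) (hηo : η ≤ o) (hol : o + l ≤ n) (ha : a < n)
    (hb : b < n) :
    PathArc (fun i : Fin (l + 2) => F (detourIndex η o l i)) (F a) (F b) ↔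
      (a + 1 = η ∧ (l ≠ 0 ∧ b = o ∨ l = 0 ∧ b = 0)) ∨ (o ≤ a ∧ a + 1 < o + l ∧ b = a + 1) ∨
        (l ≠ 0 ∧ a + 1 = o + l ∧ b = 0) := by
  rw [pathArc_iff (G := fun i => F (detourIndex η o l i))]
  constructor
  · rintro ⟨i, hi, hai, hbi⟩
    rw [h.eq_iff ha (detourIndex_lt hη hηo hol i)] at hai
    rw [h.eq_iff hb (detourIndex_lt hη hηo hol _)] at hbi
    simp only [detourIndex, Nat.succ_ne_zero, if_false] at hai hbi
    split_ifs at hai hbi <;> omega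
  · intro hab
    refine ⟨a + 1 - o, by omega, congrArg F ?_, congrArg F ?_⟩ <;>
      simp only [detourIndex, Nat.succ_ne_zero, if_false] <;> split_ifs <;> omega

theorem IsLabelling.pathArc_iff {R : ℕ → ℕ → Prop} {n a b m : ℕ} (h : IsLabelling D n F R)
    (hm : m + 2 ≤ n) (ha : a < n) (hb : b < n) :
    PathArc (fun i : Fin (m + 2) => F i) (F a) (F b) ↔ b < m + 2 ∧ b = a + 1 := by
  rw [CompSpec.pathArc_iff]
  constructor
  · rintro ⟨i, hi, hai, hbi⟩
    rw [h.eq_iff ha (by omega)] at hai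
    rw [h.eq_iff hb (by omega)] at hbi
    omega
  · rintro ⟨hlt, rfl⟩
    exact ⟨a, by omega, rfl, rfl⟩

theorem IsLabelling.isThetaPaths {R : ℕ → ℕ → Prop} {γ : ℕ}
    (h : IsLabelling D (γ + 2 + α + β) F R) (hαβ : α ≤ β) (hβ : 0 < β) :
    IsThetaPaths α β γ (F (γ + 1)) (F 0)
      (fun i => F (detourIndex (γ + 2) (γ + 2) α i))
      (fun i => F (detourIndex (γ + 2) (γ + 2 + α) β i)) fun i => F i where
  le := hαβ
  pos := hβ
  injective_P := h.injective_comp_detourIndex (by omega) le_rfl (by omega)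
  injective_Q := h.injective_comp_detourIndex (by omega) (by omega) (by omega)
  injective_R i j hij := by
    rw [h.eq_iff (by omega) (by omega)] at hij
    exact Fin.ext hij
  start_P := rfl
  start_Q := rfl
  start_R := rfl
  end_P := by simp only [detourIndex, Fin.val_last, Nat.succ_ne_zero, if_false,
    Nat.not_succ_le_self]
  end_Q := by simp only [detourIndex, Fin.val_last, Nat.succ_ne_zero, if_false,
    Nat.not_succ_le_self]
  end_R := rfl
  meet_PQ i j := h.meet_comp_detourIndex (by omega) le_rfl (by omega)
    (detourIndex_lt (by omega) (by omega) le_rfl j)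
    (by unfold detourIndex; split_ifs <;> omega) i
  meet_PR i j := h.meet_comp_detourIndex (by omega) le_rfl (by omega) (by omega) (by omega) i
  meet_QR i j := h.meet_comp_detourIndex (by omega) (by omega) le_rfl (by omega) (by omega) i
  cover v := by
    obtain ⟨a, ha, rfl⟩ := h.cover v
    rcases Nat.lt_or_ge a (γ + 2) with hR | hR
    · exact .inr (.inr ⟨⟨a, hR⟩, rfl⟩)
    rcases Nat.lt_or_ge a (γ + 2 + α) with hP | hQ
    · refine .inl ⟨⟨a + 1 - (γ + 2), by omega⟩, congrArg F ?_⟩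
      simp only [detourIndex]
      split_ifs <;> omega
    · refine .inr (.inl ⟨⟨a + 1 - (γ + 2 + α), by omega⟩, congrArg F ?_⟩)
      simp only [detourIndex]
      split_ifs <;> omega

theorem IsLabelling.isThetaDigraph
    (h : IsLabelling D (η + α + β) F (threePathRel η α β False False)) (hη : 2 ≤ η)
    (hαβ : α ≤ β) (hβ : 0 < β) : IsThetaDigraph D := by
  obtain ⟨γ, rfl⟩ := Nat.exists_eq_add_of_le' hη
  refine ⟨α, β, γ, _, _, _, _, _, h.isThetaPaths hαβ hβ, fun u v => ?_⟩
  obtain ⟨a, ha, rfl⟩ := h.cover u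
  obtain ⟨b, hb, rfl⟩ := h.cover v
  rw [h.adj_iff a ha b hb, h.pathArc_iff (by omega) ha hb,
    h.pathArc_detourIndex_iff (by omega) le_rfl (by omega) ha hb,
    h.pathArc_detourIndex_iff (by omega) (by omega) le_rfl ha hb]
  simp only [threePathRel, false_and, or_false]
  grind

theorem IsLabelling.isType2_or_isType5
    (h : IsLabelling D (η + α + β) F (threePathRel η α β True True)) (hη : 1 ≤ η) (hα : 1 ≤ α)
    (hβ : 1 ≤ β) : IsType2 D ∨ IsType5 D := by
  rcases hη.eq_or_lt with rfl | hη'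
  · exact .inl (h.isType2 hα hβ)
  rcases hα.eq_or_lt with rfl | hα'
  · obtain ⟨F, hF⟩ := h.rotate_threePaths hη hα hβ
    exact .inl (hF.isType2 hβ hη)
  rcases hβ.eq_or_lt with rfl | hβ'
  · obtain ⟨F, hF⟩ := h.swap_threePaths hη hα hβ
    obtain ⟨F, hF⟩ := hF.rotate_threePaths hη hβ hα
    exact .inl (hF.isType2 hα hη)
  exact .inr (h.isType5 hη' hα' hβ')

theorem IsLabelling.inftyFamily_or_thetaFamily
    (h : IsLabelling D (η + α + β) F (threePathRel η α β s t)) (hη : 1 ≤ η) (hα : 1 ≤ α)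
    (hβ : 1 ≤ β) : InftyFamily D ∨ ThetaFamily D := by
  wlog hst : t → s generalizing F α β s t
  · obtain ⟨F, hF⟩ := h.swap_threePaths hη hα hβ
    exact this hF hβ hα fun _ => (Classical.not_imp.mp hst).1
  by_cases hs : s
  · by_cases ht : t
    · simp only [hs, ht] at h
      exact (h.isType2_or_isType5 hη hα hβ).imp (.inr ∘ .inr) (.inr ∘ .inr ∘ .inr)
    · simp only [hs, ht] at h
      rcases hη.eq_or_lt with rfl | hη
      · exact .inl (.inr (.inl (h.isType1 hα hβ)))
      · exact .inr (.inr (.inl (h.isType3 hη hα hβ)))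
  · simp only [hs, mt hst hs] at h
    rcases hη.eq_or_lt with rfl | hη
    · exact .inl (.inl (h.isInftyDigraph hα hβ))
    wlog hαβ : α ≤ β generalizing F α β
    · obtain ⟨F, hF⟩ := h.swap_threePaths (by omega) hα hβ
      exact this hβ hα hF (by omega)
    · exact .inr (.inl (h.isThetaDigraph hη hαβ hβ))

end ThreePathsTheta

section Backward

variable {n : ℕ} {B : ℕ → ℕ → Prop}

theorem exists_enumeration_of_disjoint (hB : ∀ a b, B a b → b < a ∧ a < n)
    (hdisj : ∀ a b a' b', B a b → B a' b' → a ≤ a' → b' ≤ a → a = a' ∧ b = b')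
    (htwo : ∃ a b a' b', B a b ∧ B a' b' ∧ a ≠ a') :
    ∃ (k : ℕ) (x y : Fin k → ℕ), 2 ≤ k ∧ (∀ i j, i < j → x i < y j) ∧
      ∀ a b, B a b ↔ ∃ i, a = x i ∧ b = y i := by
  classical
  let S := (Finset.range n).filter fun a => ∃ b, B a b
  have mem_of_rel {a b : ℕ} (hab : B a b) : a ∈ S :=
    Finset.mem_filter.2 ⟨Finset.mem_range.2 (hB a b hab).2, b, hab⟩
  choose y hy using fun i => (Finset.mem_filter.1 (S.orderEmbOfFin_mem rfl i)).2
  refine ⟨S.card, S.orderEmbOfFin rfl, y, ?_, fun i j hij => ?_, fun a b => ⟨fun hab => ?_, ?_⟩⟩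
  · obtain ⟨a, b, a', b', hab, hab', hne⟩ := htwo
    exact Finset.one_lt_card.2 ⟨a, mem_of_rel hab, a', mem_of_rel hab', hne⟩
  · have hlt := (S.orderEmbOfFin rfl).strictMono hij
    by_contra! hle
    exact hlt.ne (hdisj _ _ _ _ (hy i) (hy j) hlt.le hle).1
  · obtain ⟨i, rfl⟩ : a ∈ Set.range (S.orderEmbOfFin rfl) := by
      rw [Finset.range_orderEmbOfFin]
      exact mem_of_rel hab
    exact ⟨i, rfl, (hdisj _ _ _ _ hab (hy i) le_rfl (hB _ _ (hy i)).1.le).2⟩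
  · rintro ⟨i, rfl, rfl⟩
    exact hy i

theorem IsLabelling.isType4 {V : Type*} {D : Digraph V} {F : ℕ → V}
    (h : IsLabelling D n F fun a b => (b = a + 1 ∨ a + 1 = n ∧ b = 0) ∨ B a b) (hn : 0 < n)
    (hB : ∀ a b, B a b → b < a ∧ a < n)
    (hdisj : ∀ a b a' b', B a b → B a' b' → a ≤ a' → b' ≤ a → a = a' ∧ b = b')
    (htwo : ∃ a b a' b', B a b ∧ B a' b' ∧ a ≠ a') : IsType4 D := by
  obtain ⟨k, x, y, hk, hxy, hBxy⟩ := exists_enumeration_of_disjoint hB hdisj htwo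
  have hlt (i : Fin k) : y i < x i ∧ x i < n := hB _ _ ((hBxy _ _).2 ⟨i, rfl, rfl⟩)
  refine ⟨n, cyclicLabel n F, k, fun i => x i + 1, fun i => y i + 1, h.bijective_cyclicLabel hn, hk,
    fun i => ⟨Nat.succ_pos _, Nat.succ_lt_succ (hlt i).1, (hlt i).2⟩,
    fun i j hij => Nat.succ_lt_succ (hxy i j hij), fun u v => ?_⟩
  obtain ⟨a, ha, rfl⟩ := h.cover u
  obtain ⟨b, hb, rfl⟩ := h.cover v
  rw [h.adj_iff a ha b hb, h.cycleArc_iff hn le_rfl ha hb, hBxy]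
  simp only [ha, hb, true_and]
  refine or_congr_right (exists_congr fun i => ?_)
  rw [cyclicLabel_natCast_add_one F (hlt i).2,
    cyclicLabel_natCast_add_one F ((hlt i).1.trans (hlt i).2), h.eq_iff ha (hlt i).2,
    h.eq_iff hb ((hlt i).1.trans (hlt i).2)]

end Backward

section JoinLabel

variable {V : Type*} {D : Digraph V} {r m x y : ℕ} {c p : ℕ → V}

/-- The enumeration `c 0, …, c (r - 1), p 0, p 1, …`. -/
def joinLabel (r : ℕ) (c p : ℕ → V) (k : ℕ) : V :=
  if k < r then c k else p (k - r)

/-- The arcs of a cycle `c` of length `r` with an ear `p`, in terms of the indices of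
`joinLabel r c p`: those of the cycle, from the cycle to the ear and back, along the ear, and
backward inside the ear. -/
def earRel (D : Digraph V) (r m : ℕ) (c p : ℕ → V) (a b : ℕ) : Prop :=
  (a < r ∧ b < r ∧ (b = a + 1 ∨ a + 1 = r ∧ b = 0)) ∨ (a < r ∧ b = r ∧ D.Adj (c a) (p 0)) ∨
    (a + 1 = r + m ∧ b < r ∧ D.Adj (p (m - 1)) (c b)) ∨ (r ≤ a ∧ b = a + 1) ∨
    (r ≤ b ∧ b ≤ a ∧ D.Adj (p (a - r)) (p (b - r)))

theorem joinLabel_of_lt {k : ℕ} (hk : k < r) : joinLabel r c p k = c k :=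
  if_pos hk

theorem joinLabel_of_le {k : ℕ} (hk : r ≤ k) : joinLabel r c p k = p (k - r) :=
  if_neg hk.not_gt

theorem IsInducedCycle.adj_iff_of_lt (hc : IsInducedCycle D r c) {a b : ℕ} (ha : a < r)
    (hb : b < r) : D.Adj (c a) (c b) ↔ b = a + 1 ∨ a + 1 = r ∧ b = 0 := by
  rw [hc.adj_iff, Nat.ModEq, Nat.mod_eq_of_lt hb]
  rcases (Nat.succ_le_of_lt ha).lt_or_eq with hlt | rfl
  · rw [Nat.mod_eq_of_lt hlt]
    omega
  · rw [Nat.mod_self]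
    omega

namespace IsCycleWithEar

theorem adj_joinLabel_iff (h : IsCycleWithEar D r m c p) {a b : ℕ} (ha : a < r + m)
    (hb : b < r + m) :
    D.Adj (joinLabel r c p a) (joinLabel r c p b) ↔ earRel D r m c p a b := by
  have hpos := h.pos
  rcases Nat.lt_or_ge a r with hac | hap <;> rcases Nat.lt_or_ge b r with hbc | hbp
  · rw [joinLabel_of_lt hac, joinLabel_of_lt hbc, h.cycle.adj_iff_of_lt hac hbc, earRel]
    omega
  · have enter : D.Adj (c a) (p (b - r)) ↔ b = r ∧ D.Adj (c a) (p 0) := by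
      refine ⟨fun hab => ?_, fun ⟨hbr, hab⟩ => by rwa [hbr, Nat.sub_self]⟩
      have := h.enter a _ (by omega) hab
      exact ⟨by omega, this ▸ hab⟩
    rw [joinLabel_of_lt hac, joinLabel_of_le hbp, earRel, enter]
    grind
  · have leave : D.Adj (p (a - r)) (c b) ↔ a + 1 = r + m ∧ D.Adj (p (m - 1)) (c b) := by
      refine ⟨fun hab => ?_, fun ⟨_, hab⟩ => by rwa [show a - r = m - 1 by omega]⟩
      have := h.leave _ (by omega) b hab
      exact ⟨by omega, by rwa [show m - 1 = a - r by omega]⟩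
    rw [joinLabel_of_le hap, joinLabel_of_lt hbc, earRel, leave]
    grind
  · have forward (hab : b = a + 1) : D.Adj (p (a - r)) (p (b - r)) := by
      rw [hab, Nat.sub_add_comm hap]
      exact h.walk _ (by omega)
    have noskip := h.noskip (a - r) (by omega) (b - r) (by omega)
    rw [joinLabel_of_le hap, joinLabel_of_le hbp, earRel]
    grind

theorem isLabelling (h : IsCycleWithEar D r m c p) (hthin : IsThin D) (hx : D.Adj (c x) (p 0))
    (hy : D.Adj (p (m - 1)) (c y)) :
    IsLabelling D (r + m) (joinLabel r c p) (earRel D r m c p) where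
  injOn a ha b hb hab := by
    rw [Set.mem_Iio] at ha hb
    rcases Nat.lt_or_ge a r with hac | hap <;> rcases Nat.lt_or_ge b r with hbc | hbp
    · rw [joinLabel_of_lt hac, joinLabel_of_lt hbc, h.cycle.eq_iff] at hab
      exact hab.eq_of_lt_of_lt hac hbc
    · rw [joinLabel_of_lt hac, joinLabel_of_le hbp] at hab
      exact absurd hab (h.disj _ _ (by omega))
    · rw [joinLabel_of_le hap, joinLabel_of_lt hbc] at hab
      exact absurd hab.symm (h.disj _ _ (by omega))
    · rw [joinLabel_of_le hap, joinLabel_of_le hbp] at hab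
      have := h.inj _ (by omega) _ (by omega) hab
      omega
  cover v := by
    have hr := h.cycle.two_le
    rcases h.cover hthin hx hy v with ⟨a, rfl⟩ | ⟨b, hb, rfl⟩
    · have hlt : a % r < r := Nat.mod_lt a (by omega)
      exact ⟨a % r, by omega, by rw [joinLabel_of_lt hlt, h.cycle.apply_mod]⟩
    · exact ⟨r + b, by omega, by rw [joinLabel_of_le (by omega), Nat.add_sub_cancel_left]⟩
  adj_iff a ha b hb := h.adj_joinLabel_iff ha hb

theorem eq_or_eq_of_enter (h : IsCycleWithEar D r m c p) (hthin : IsThin D) (hxr : x + 1 < r)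
    (hx : D.Adj (c x) (p 0)) (h0 : D.Adj (p (m - 1)) (c 0)) {a : ℕ} (har : a < r)
    (ha : D.Adj (c a) (p 0)) : a = x ∨ a + 1 = r := by
  by_contra! hne
  rcases hne.1.lt_or_gt with hlt | hgt
  · exact h.not_adj_enter hthin (by omega) hx h0 (Nat.zero_le a) hlt ha
  · exact h.not_adj_enter hthin (by omega) ha h0 (Nat.zero_le x) hgt hx

theorem eq_or_eq_of_leave (h : IsCycleWithEar D r m c p) (hthin : IsThin D) (hxr : x + 1 < r)
    (hx : D.Adj (c x) (p 0)) (h0 : D.Adj (p (m - 1)) (c 0)) {b : ℕ} (hbr : b < r)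
    (hb : D.Adj (p (m - 1)) (c b)) : b = 0 ∨ b = x + 1 := by
  by_contra! hne
  rcases Nat.lt_or_ge x b with hlt | hge
  · have hx' : D.Adj (c (x + r * 1)) (p 0) := by rwa [h.cycle.apply_add_mul]
    have h0' : D.Adj (p (m - 1)) (c (0 + r * 1)) := by rwa [h.cycle.apply_add_mul]
    exact h.not_adj_leave hthin (by omega) hx' hb (by omega) (by omega) h0'
  · exact h.not_adj_leave hthin (by omega) hx h0 (by omega) hge hb

theorem isLabelling_threePathRel (h : IsCycleWithEar D r m c p) (hthin : IsThin D)
    (hxr : x + 1 < r) (hx : D.Adj (c x) (p 0)) (h0 : D.Adj (p (m - 1)) (c 0)) :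
    IsLabelling D (x + 1 + (r - (x + 1)) + m) (joinLabel r c p)
      (threePathRel (x + 1) (r - (x + 1)) m (D.Adj (c (r - 1)) (p 0))
        (D.Adj (p (m - 1)) (c (x + 1)))) := by
  rw [Nat.add_sub_cancel' hxr.le]
  refine (h.isLabelling hthin hx h0).reindex (Set.bijOn_id _) fun a ha b hb => ?_
  have henter : a < r → (D.Adj (c a) (p 0) ↔ a = x ∨ a + 1 = r ∧ D.Adj (c (r - 1)) (p 0)) := by
    refine fun har => ⟨fun hab => ?_, ?_⟩
    · rcases h.eq_or_eq_of_enter hthin hxr hx h0 har hab with hax | hlast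
      · exact .inl hax
      · exact .inr ⟨hlast, by rwa [← hlast, Nat.add_sub_cancel]⟩
    · rintro (rfl | ⟨rfl, hab⟩)
      exacts [hx, by rwa [Nat.add_sub_cancel] at hab]
  have hleave : b < r →
      (D.Adj (p (m - 1)) (c b) ↔ b = 0 ∨ b = x + 1 ∧ D.Adj (p (m - 1)) (c (x + 1))) := by
    refine fun hbr => ⟨fun hab => ?_, ?_⟩
    · rcases h.eq_or_eq_of_leave hthin hxr hx h0 hbr hab with hzero | rfl
      exacts [.inl hzero, .inr ⟨rfl, hab⟩]
    · rintro (rfl | ⟨rfl, hab⟩)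
      exacts [h0, hab]
  have hback : b ≤ a → ¬ D.Adj (p (a - r)) (p (b - r)) := fun hba =>
    h.not_adj_back hthin (Nat.zero_le x) (by omega) hx h0 (by omega) (by have := h.pos; omega)
  have hpos := h.pos
  rw [threePathRel, earRel, Nat.add_sub_cancel' hxr.le]
  grind

theorem inftyFamily_or_thetaFamily_of_lt (h : IsCycleWithEar D r m c p) (hthin : IsThin D)
    (hxr : x + 1 < r) (hx : D.Adj (c x) (p 0)) (h0 : D.Adj (p (m - 1)) (c 0)) :
    InftyFamily D ∨ ThetaFamily D :=
  (h.isLabelling_threePathRel hthin hxr hx h0).inftyFamily_or_thetaFamily x.succ_pos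
    (Nat.sub_pos_of_lt hxr) h.pos

theorem isLabelling_of_unique (h : IsCycleWithEar D r m c p) (hthin : IsThin D)
    (hx : D.Adj (c (r - 1)) (p 0)) (h0 : D.Adj (p (m - 1)) (c 0))
    (henter : ∀ a < r, D.Adj (c a) (p 0) → a + 1 = r)
    (hleave : ∀ b < r, D.Adj (p (m - 1)) (c b) → b = 0) :
    IsLabelling D (r + m) (joinLabel r c p) fun a b =>
      (b = a + 1 ∨ a + 1 = r + m ∧ b = 0) ∨ (a + 1 = r ∧ b = 0) ∨
        (r ≤ b ∧ b ≤ a ∧ D.Adj (p (a - r)) (p (b - r))) := by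
  refine (h.isLabelling hthin hx h0).reindex (Set.bijOn_id _) fun a ha b hb => ?_
  have enter_iff : a < r → (D.Adj (c a) (p 0) ↔ a + 1 = r) := fun har =>
    ⟨henter a har, by rintro rfl; rwa [Nat.add_sub_cancel] at hx⟩
  have leave_iff : b < r → (D.Adj (p (m - 1)) (c b) ↔ b = 0) := fun hbr =>
    ⟨hleave b hbr, by rintro rfl; exact h0⟩
  have hr := h.cycle.two_le
  rw [earRel]
  grind

theorem isThetaDigraph_of_unique (h : IsCycleWithEar D r m c p) (hthin : IsThin D)
    (hx : D.Adj (c (r - 1)) (p 0)) (h0 : D.Adj (p (m - 1)) (c 0))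
    (henter : ∀ a < r, D.Adj (c a) (p 0) → a + 1 = r)
    (hleave : ∀ b < r, D.Adj (p (m - 1)) (c b) → b = 0)
    (hback : ∀ a < m, ∀ b ≤ a, ¬ D.Adj (p a) (p b)) : IsThetaDigraph D := by
  have hr := h.cycle.two_le
  have hpos := h.pos
  have hF : IsLabelling D (r + 0 + m) (joinLabel r c p) (threePathRel r 0 m False False) := by
    refine (h.isLabelling_of_unique hthin hx h0 henter hleave).reindex (Set.bijOn_id _)
      fun a ha b _ => ?_
    have := hback (a - r) (by omega) (b - r)
    rw [threePathRel]
    grind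
  exact hF.isThetaDigraph hr hpos.le hpos

theorem isType4_of_unique (h : IsCycleWithEar D r m c p) (hsimple : IsSimple D) (hthin : IsThin D)
    (hx : D.Adj (c (r - 1)) (p 0)) (h0 : D.Adj (p (m - 1)) (c 0))
    (henter : ∀ a < r, D.Adj (c a) (p 0) → a + 1 = r)
    (hleave : ∀ b < r, D.Adj (p (m - 1)) (c b) → b = 0) {a₀ b₀ : ℕ} (ha₀ : a₀ < m) (hb₀ : b₀ ≤ a₀)
    (hback : D.Adj (p a₀) (p b₀)) : IsType4 D := by
  have hr := h.cycle.two_le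
  let B a b := (a + 1 = r ∧ b = 0) ∨ (r ≤ b ∧ b < a ∧ a < r + m ∧ D.Adj (p (a - r)) (p (b - r)))
  have ne_of_adj {a b : ℕ} (hab : D.Adj (p (a - r)) (p (b - r))) : a ≠ b := by
    rintro rfl
    exact hsimple _ hab
  have hF : IsLabelling D (r + m) (joinLabel r c p) fun a b =>
      (b = a + 1 ∨ a + 1 = r + m ∧ b = 0) ∨ B a b := by
    refine (h.isLabelling_of_unique hthin hx h0 henter hleave).reindex (Set.bijOn_id _)
      fun a ha b _ => or_congr_right (or_congr_right ?_)
    exact ⟨fun ⟨hrb, hba, hab⟩ => ⟨hrb, hba.lt_of_ne (ne_of_adj hab).symm, ha, hab⟩,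
      fun ⟨hrb, hba, _, hab⟩ => ⟨hrb, hba.le, hab⟩⟩
  refine hF.isType4 (by omega) (by grind) ?_ ⟨r - 1, 0, r + a₀, r + b₀, ?_, ?_, by omega⟩
  · rintro a b a' b' (hab | ⟨hrb, hba, _, hab⟩) (hab' | ⟨hrb', hba', ha', hab'⟩) haa' hb'a
    · omega
    · omega
    · omega
    · have := h.back_disjoint hthin (by omega) (by omega) hab hab' (by omega) (by omega)
      omega
  · exact .inl ⟨by omega, rfl⟩
  · have hab : D.Adj (p (r + a₀ - r)) (p (r + b₀ - r)) := by
      simpa only [Nat.add_sub_cancel_left] using hback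
    have := ne_of_adj hab
    exact .inr ⟨by omega, by omega, by omega, hab⟩

theorem exists_shift (h : IsCycleWithEar D r m c p) (hx : D.Adj (c x) (p 0))
    (hy : D.Adj (p (m - 1)) (c y)) :
    ∃ c' x', IsCycleWithEar D r m c' p ∧ x' < r ∧ D.Adj (c' x') (p 0) ∧
      D.Adj (p (m - 1)) (c' 0) := by
  have hr := h.cycle.two_le
  have hyr : y ≤ r * y := Nat.le_mul_of_pos_left y (by omega)
  refine ⟨fun k => c (k + y), (x + r * y - y) % r, h.shift y, Nat.mod_lt _ (by omega), ?_,
    by simpa only [zero_add] using hy⟩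
  simpa only [(h.shift y).cycle.apply_mod, Nat.sub_add_cancel (show y ≤ x + r * y by omega),
    h.cycle.apply_add_mul] using hx

theorem inftyFamily_or_thetaFamily (h : IsCycleWithEar D r m c p) (hsimple : IsSimple D)
    (hthin : IsThin D) (hx : D.Adj (c x) (p 0)) (hy : D.Adj (p (m - 1)) (c y)) :
    InftyFamily D ∨ ThetaFamily D := by
  obtain ⟨c, x, h, hxr, hx, h0⟩ := h.exists_shift hx hy
  by_cases henter : ∃ a, a + 1 < r ∧ D.Adj (c a) (p 0)
  · obtain ⟨a, har, ha⟩ := henter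
    exact h.inftyFamily_or_thetaFamily_of_lt hthin har ha h0
  have henter' (a : ℕ) (har : a < r) (ha : D.Adj (c a) (p 0)) : a + 1 = r := by
    by_contra hne
    exact henter ⟨a, by omega, ha⟩
  obtain rfl := henter' x hxr hx
  by_cases hleave : ∃ b, 0 < b ∧ b < x + 1 ∧ D.Adj (p (m - 1)) (c b)
  · obtain ⟨b, hb, hbr, hadj⟩ := hleave
    exact (h.shift b).inftyFamily_or_thetaFamily_of_lt (x := x - b) hthin (by omega)
      (by rwa [Nat.sub_add_cancel (Nat.le_of_lt_succ hbr)]) (by rwa [zero_add])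
  have hleave' (b : ℕ) (hbr : b < x + 1) (hb : D.Adj (p (m - 1)) (c b)) : b = 0 := by
    by_contra hne
    exact hleave ⟨b, by omega, hbr, hb⟩
  by_cases hback : ∃ a < m, ∃ b ≤ a, D.Adj (p a) (p b)
  · obtain ⟨a, ha, b, hb, hab⟩ := hback
    exact .inr <| .inr <| .inr <| .inl <|
      h.isType4_of_unique hsimple hthin hx h0 henter' hleave' ha hb hab
  · push Not at hback
    exact .inr (.inl (h.isThetaDigraph_of_unique hthin hx h0 henter' hleave' hback))

end IsCycleWithEar

end JoinLabel

section Classification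

variable {V : Type*} {D : Digraph V}

theorem IsThin.inftyFamily_or_thetaFamily (hthin : IsThin D) (hsimple : IsSimple D)
    (hstrong : IsStronglyConnected D) {u v w : V} (huv : D.Adj u v) (huw : D.Adj u w)
    (hvw : v ≠ w) : InftyFamily D ∨ ThetaFamily D := by
  obtain ⟨r, m, c, p, x, y, h, hx, hy⟩ := exists_isCycleWithEar hsimple hstrong huv huw hvw
  exact h.inftyFamily_or_thetaFamily hsimple hthin hx hy

end Classification

end CompSpec

/-- A strongly connected finite simple digraph with exactly three complementarity eigenvalues
belongs to the `∞`-family or to the `θ`-family. -/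
theorem mainTheorem1 {V : Type*} [Fintype V] (D : Digraph V)
    (hsimple : CompSpec.IsSimple D) (hstrong : CompSpec.IsStronglyConnected D)
    (hthree : (CompSpec.complementaritySpectrum D).ncard = 3) :
    CompSpec.InftyFamily D ∨ CompSpec.ThetaFamily D := by
  obtain ⟨u, v, w, huv, huw, hvw⟩ :=
    CompSpec.exists_two_adj_of_ncard_complementaritySpectrum_eq_three hthree
  obtain ⟨r, c, hc⟩ := CompSpec.exists_isInducedCycle hsimple hstrong huv
  have hone := CompSpec.one_mem_complementaritySpectrum (Set.range_nonempty c)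
    fun _ hu => hc.existsUnique_adj hu
  have hthin :=
    CompSpec.isThin_of_ncard_complementaritySpectrum_eq_three hsimple hstrong hthree hone
  exact hthin.inftyFamily_or_thetaFamily hsimple hstrong huv huw hvw
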